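/- **Setting.** For each $n$ let $m=m(n)\ge 1$, $k=k(n)\ge 1$ be integers with $mk\le n$ (for all large $n$), and let $\vartheta_\ell=(\vartheta_{\ell,u})_{u\in[k]\times[k]}$, $\ell\in[m]$, be real $k\times k$ arrays (templates), which may depend on $n$. A block is a product $B=S\times T\subset[n]\times[n]$ with $|S|=|T|=k$; for $(i,j)\in B$ let $\varphi_B(i,j)=(u,v)$ if $i$ is the $u$-th smallest element of $S$ and $j$ is the $v$-th smallest element of $T$. The non-consecutive placement family $\mathcal K_{k,m,n}$ consists of all collections of $m$ pairwise disjoint blocks. The circular consecutive placement family $\mathcal K^{\circ}_{k,m,n}$ consists of those collections in which the row set $S$ and the column set $T$ of every block are of the form $\{i+1,\dots,i+k\}\bmod n$, $0\le i\le n-1$. Let $\mathbb P_{\mathcal H_0}$ be the law of an $n\times n$ matrix with i.i.d. $\mathcal N(0,1)$ entries. Let $\mathbb P_{\mathcal H_1}$ be the law of the $n\times n$ matrix $X$ obtained as follows: draw $K$ uniformly from the placement family and, given $K$, a uniformly random bijection $\beta:K\to[m]$; given $(K,\beta)$ the entries are independent, $X_{ij}\sim\mathcal P_{\beta(B),\varphi_B(i,j)}$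 if $(i,j)\in B$ for some $B\in K$, and $X_{ij}\sim\mathcal N(0,1)$ otherwise. Here either $\mathcal P_{\ell,u}=\mathcal N(\vartheta_{\ell,u},1)$ (mean-shift model), or $\mathcal P_{\ell,u}=\mathcal N(0,1+\vartheta_{\ell,u})$ with $0\le\vartheta_{\ell,u}\le\vartheta_0$ for all $\ell,u$ and a constant $\vartheta_0<1$ independent of $n$ (variance-shift model). Put $\mathcal E_\ell=\sum_u\vartheta_{\ell,u}^2$, $\mathcal E=\max_{\ell\in[m]}\mathcal E_\ell$, $\|\vartheta_\ell\|_\infty=\max_u|\vartheta_{\ell,u}|$, and $d_{\mathrm{TV}}(\mathbb P,\mathbb Q)=\frac12\int|d\mathbb P-d\mathbb Q|$. All asymptotics are for $n\to\infty$. **Corollary (Smooth-signal lower bounds).** Assume the smooth-signal regime: there is a constant $C$, independent of $n$, such that for all large $n$ and all $\ell\in[m]$, $\|\vartheta_\ell\|_\infty\le C$ and $k^2\|\vartheta_\ell\|_\infty^2\le C\,\mathcal E_\ell$. Then, in the mean-shift model as well as in the variance-shift model: 1. under the non-consecutive placement family $\mathcal K_{k,m,n}$, if $\mathcal E=o\!\left(k\wedge\frac{n^2}{m^2k^2}\right)$,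 then $d_{\mathrm{TV}}(\mathbb P_{\mathcal H_0},\mathbb P_{\mathcal H_1})=o(1)$, so that detection is impossible; 2. under the circular consecutive placement family $\mathcal K^{\circ}_{k,m,n}$, if $\mathcal E=o\!\left(\log\!\left(1+\frac{n^2}{k^2m^2}\right)\right)$, then $d_{\mathrm{TV}}(\mathbb P_{\mathcal H_0},\mathbb P_{\mathcal H_1})=o(1)$, so that detection is impossible. -/

import Mathlib

open MeasureTheory ProbabilityTheory Filter Topology Asymptotics
open scoped ENNReal NNReal

noncomputable section

namespace Submatrix

/-- A `k × k` block `S × T` of `[n] × [n]`, recorded by its row set `S` and its column set `T`,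
both of size `k`. The index set `[n]` is `Fin n` (all indices are shifted by one). -/
abbrev Block (n k : ℕ) : Type :=
  {S : Finset (Fin n) // S.card = k} × {T : Finset (Fin n) // T.card = k}

/-- The set of matrix entries of the block, `S × T ⊆ [n] × [n]`. -/
def Block.entries {n k : ℕ} (B : Block n k) : Finset (Fin n × Fin n) :=
  B.1.1 ×ˢ B.2.1

/-- The coordinate map `φ_B : S × T → [k] × [k]`: the position of the row index in the increasing
enumeration of `S`, and of the column index in the increasing enumeration of `T`. -/
def Block.coord {n k : ℕ} (B : Block n k) (p : Fin n × Fin n) (hp : p ∈ B.entries) :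
    Fin k × Fin k :=
  ((B.1.1.orderIsoOfFin B.1.2).symm ⟨p.1, (Finset.mem_product.mp hp).1⟩,
   (B.2.1.orderIsoOfFin B.2.2).symm ⟨p.2, (Finset.mem_product.mp hp).2⟩)

/-- The circular interval `{i, i + 1, …, i + k - 1}` modulo `n`. -/
def circInterval {n : ℕ} (k : ℕ) (i : Fin n) : Finset (Fin n) :=
  (Finset.range k).image fun j => ⟨(i.1 + j) % n, Nat.mod_lt _ i.pos⟩

/-- The family of all `k × k` blocks. -/
def allBlocks (n k : ℕ) : Finset (Block n k) := Finset.univ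

open Classical in
/-- The family of the blocks whose row set and column set are both circular intervals. -/
def circBlocks (n k : ℕ) : Finset (Block n k) :=
  Finset.univ.filter fun B =>
    (∃ i : Fin n, B.1.1 = circInterval k i) ∧ (∃ i : Fin n, B.2.1 = circInterval k i)

open Classical in
/-- The placement family: all unordered collections of `m` pairwise disjoint blocks from `𝓑`. -/
def placements {n k : ℕ} (𝓑 : Finset (Block n k)) (m : ℕ) : Finset (Finset (Block n k)) :=
  (𝓑.powersetCard m).filter fun K => (K : Set (Block n k)).PairwiseDisjoint Block.entries

/-- The standard normal law. -/
def stdNormal : Measure ℝ := gaussianReal 0 1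

open Classical in
/-- The law of the entry at `p`, given the planted collection `K` and the labeling `β : K → [m]`:
it is `P_{β(B), φ_B(p)}` if `p` lies in a block `B` of `K` (unique, as the blocks of a placement
are disjoint), and standard normal otherwise. -/
def entryLaw {n k m : ℕ} (P : Fin m → Fin k × Fin k → Measure ℝ) (K : Finset (Block n k))
    (β : {B // B ∈ K} ≃ Fin m) (p : Fin n × Fin n) : Measure ℝ :=
  if h : ∃ B : {B // B ∈ K}, p ∈ B.1.entries then
    P (β h.choose) (h.choose.1.coord p h.choose_spec)
  else stdNormal

/-- The null law: independent standard normal entries. -/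
def nullLaw (n : ℕ) : Measure (Fin n × Fin n → ℝ) :=
  Measure.pi fun _ => stdNormal

open Classical in
/-- The alternative: the mixture over a uniformly random placement `K` and, given `K`, a uniformly
random bijection `β : K → [m]`, of the product laws with the entry laws above. -/
def altLaw {n k m : ℕ} (𝓑 : Finset (Block n k)) (P : Fin m → Fin k × Fin k → Measure ℝ) :
    Measure (Fin n × Fin n → ℝ) :=
  ((placements 𝓑 m).card : ℝ≥0∞)⁻¹ • ∑ K ∈ placements 𝓑 m,
    (Fintype.card ({B // B ∈ K} ≃ Fin m) : ℝ≥0∞)⁻¹ • ∑ β : {B // B ∈ K} ≃ Fin m,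
      Measure.pi fun p => entryLaw P K β p

/-- Total variation distance `½ ∫ |dμ - dν|`, with densities taken with respect to `μ + ν`. -/
def tvDist {Ω : Type*} [MeasurableSpace Ω] (μ ν : Measure Ω) : ℝ :=
  (1 / 2) * ∫ x, |(μ.rnDeriv (μ + ν) x).toReal - (ν.rnDeriv (μ + ν) x).toReal| ∂(μ + ν)

/-- Mean-shift templates: `P_{ℓ,u} = N(ϑ_{ℓ,u}, 1)`. -/
def meanShift {k m : ℕ} (ϑ : Fin m → Fin k × Fin k → ℝ) : Fin m → Fin k × Fin k → Measure ℝ :=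
  fun ℓ u => gaussianReal (ϑ ℓ u) 1

/-- Variance-shift templates: `P_{ℓ,u} = N(0, 1 + ϑ_{ℓ,u})` (used only for `ϑ ≥ 0`). -/
def varShift {k m : ℕ} (ϑ : Fin m → Fin k × Fin k → ℝ) : Fin m → Fin k × Fin k → Measure ℝ :=
  fun ℓ u => gaussianReal 0 (1 + ϑ ℓ u).toNNReal

/-- The energy `∑_u ϑ_u²` of one template. -/
def templateEnergy {k : ℕ} (θ : Fin k × Fin k → ℝ) : ℝ := ∑ u, θ u ^ 2

/-- The signal energy: the maximum of the template energies. -/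
def energy {k m : ℕ} (ϑ : Fin m → Fin k × Fin k → ℝ) : ℝ := ⨆ ℓ, templateEnergy (ϑ ℓ)

/-- The smooth-signal regime. Here `‖ϑ n ℓ‖` is the sup norm `max_u |ϑ_{ℓ,u}|`. The second
condition is non-spikiness, `k² ‖ϑ_ℓ‖∞² / E_ℓ ≤ C`, multiplied out so that it also reads correctly
for a zero template. -/
def SmoothSignal (m k : ℕ → ℕ) (ϑ : ∀ n, Fin (m n) → Fin (k n) × Fin (k n) → ℝ) : Prop :=
  (∃ C : ℝ, ∀ᶠ n in atTop, ∀ ℓ, ‖ϑ n ℓ‖ ≤ C) ∧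
  (∃ C : ℝ, ∀ᶠ n in atTop, ∀ ℓ, (k n : ℝ) ^ 2 * ‖ϑ n ℓ‖ ^ 2 ≤ C * templateEnergy (ϑ n ℓ))

/-- Standing assumption of the variance-shift model: nonnegative variance shifts, bounded by a
constant `ϑ₀ < 1` that does not depend on `n`. -/
def VarAdmissible (m k : ℕ → ℕ) (ϑ : ∀ n, Fin (m n) → Fin (k n) × Fin (k n) → ℝ) : Prop :=
  ∃ ϑ₀ : ℝ, ϑ₀ < 1 ∧ ∀ᶠ n in atTop, ∀ ℓ u, 0 ≤ ϑ n ℓ u ∧ ϑ n ℓ u ≤ ϑ₀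

/-- The law of the data under the alternative is asymptotically indistinguishable from the null
law, `d_TV(P_{H₀}, P_{H₁}) = o(1)`, for the given block families and entry laws. -/
def DetectionImpossible (m k : ℕ → ℕ) (𝓑 : ∀ n, Finset (Block n (k n)))
    (P : ∀ n, Fin (m n) → Fin (k n) × Fin (k n) → Measure ℝ) : Prop :=
  Tendsto (fun n => tvDist (nullLaw n) (altLaw (𝓑 n) (P n))) atTop (𝓝 0)

end Submatrix

end

namespace Submatrix

/-! ### Total variation and second moments -/

/-! The proof is a second moment argument. A placement with a labelling is an ordered tuple `ω` of
disjoint blocks, so the alternative is a uniform mixture over tuples, with likelihood ratios `L_ω`.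
Smoothness bounds every squared template value by a constant times `E / k²`. Hence any two entry
densities, whatever their labels and positions, have correlation at most `exp lam` with `lam` of
order `E / k²`: the correlation is `exp (a b)` for mean shifts and `(1 - a b)^(-1/2)` for variance
shifts. An entry planted in at most one of `ω`, `ω'` contributes the factor 1, so `L_ω L_ω'` has
null mean at most `exp (lam * |planted ω ∩ planted ω'|)`. It remains to show that the exponential
moment of the overlap of two independent placements tends to 1, possibly after discarding a
vanishing fraction of placements.

Circular family: resample one block at a time (`sum_prod_le_of_resampling`). Given the others, a
block has at least `n² / 2` positions, of which at most `4 m k²` meet `planted ω'`. This bounds the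
moment by the exponential of `8 m² k² / n² * (exp (lam k²) - 1)`, and the logarithmic threshold
makes that small through Bernoulli's inequality. When `8 k > n` everything is bounded.

Non-consecutive family: the mean overlap is of order `m² k⁴ / n²`, and three regimes show that it
governs the exponential moment. If `2 m k ≤ n`, then given the other blocks and its own columns, a
block has a row set uniform among the `k`-subsets of at least half of the rows; rows and columns are
averaged in turn, which needs only `lam k` small. If `2 m k > n`, the threshold already makes `lam
k²` small. For `2 k³ ≤ n` most blocks avoid a given placement and whole blocks can be resampled. For
`n < 2 k³` resampling fails, and the symmetry under independent row and column permutations replaces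
it. This needs every line of the matrix to carry `O(k²)` planted entries, so the mixture is
restricted to balanced placements; a switching argument shows that the excluded fraction is at most
`4 / k`, and `k` tends to infinity along this regime. -/

theorem tvDist_withDensity {Ω : Type*} [MeasurableSpace Ω] (μ : Measure Ω) [IsProbabilityMeasure μ]
    (L : Ω → ℝ) (hL : Measurable L) (h0 : ∀ x, 0 ≤ L x) (hi : Integrable L μ) :
    tvDist μ (μ.withDensity fun x => ENNReal.ofReal (L x)) = 1 / 2 * ∫ x, |1 - L x| ∂μ := by
  have hfin : IsFiniteMeasure (μ.withDensity fun x => ENNReal.ofReal (L x)) :=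
    isFiniteMeasure_withDensity_ofReal hi.2
  set ν := μ.withDensity fun x => ENNReal.ofReal (L x) with hν
  have hsum : μ + ν = μ.withDensity fun x => ENNReal.ofReal (1 + L x) := by
    have h1 : (fun x => ENNReal.ofReal (1 + L x))
        = (fun _ => (1 : ℝ≥0∞)) + fun x => ENNReal.ofReal (L x) := by
      funext x
      simp [ENNReal.ofReal_add zero_le_one (h0 x)]
    rw [h1, withDensity_add_left measurable_const]
    simp [hν]
  have hm1 : Measurable fun x => ENNReal.ofReal (1 + L x) := by fun_prop
  -- Used with `g = 1` and `g = L`: the densities of the two measures with respect to `μ + ν` are `1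
  -- / (1 + L)` and `L / (1 + L)`.
  have key : ∀ g : Ω → ℝ, Measurable g →
      μ.withDensity (fun x => ENNReal.ofReal (g x)) =
        (μ + ν).withDensity fun x => ENNReal.ofReal (g x / (1 + L x)) := by
    intro g hg
    rw [hsum, ← withDensity_mul _ hm1 (by fun_prop)]
    congr 1
    funext x
    have : 0 < 1 + L x := by linarith [h0 x]
    simp only [Pi.mul_apply]
    rw [← ENNReal.ofReal_mul this.le, mul_div_cancel₀ _ this.ne']
  have hμ : μ.rnDeriv (μ + ν) =ᵐ[μ + ν] fun x => ENNReal.ofReal (1 / (1 + L x)) := by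
    have h := key (fun _ => 1) measurable_const
    have h' := Measure.rnDeriv_withDensity (μ + ν)
      (f := fun x => ENNReal.ofReal (1 / (1 + L x))) (by fun_prop)
    rw [← h] at h'
    simpa using h'
  have hν' : ν.rnDeriv (μ + ν) =ᵐ[μ + ν] fun x => ENNReal.ofReal (L x / (1 + L x)) := by
    have h := key L hL
    have h' := Measure.rnDeriv_withDensity (μ + ν)
      (f := fun x => ENNReal.ofReal (L x / (1 + L x))) (by fun_prop)
    rw [← h] at h'
    exact h'
  unfold tvDist
  congr 1
  have e1 : ∫ x, |(μ.rnDeriv (μ + ν) x).toReal - (ν.rnDeriv (μ + ν) x).toReal| ∂(μ + ν)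
      = ∫ x, |1 - L x| / (1 + L x) ∂(μ + ν) := by
    refine integral_congr_ae ?_
    filter_upwards [hμ, hν'] with x hx hx'
    have : 0 < 1 + L x := by linarith [h0 x]
    rw [hx, hx', ENNReal.toReal_ofReal (by positivity),
      ENNReal.toReal_ofReal (div_nonneg (h0 x) this.le), ← sub_div, abs_div, abs_of_pos this]
  rw [e1, hsum, integral_withDensity_eq_integral_toReal_smul hm1 (by simp)]
  refine integral_congr_ae (Eventually.of_forall fun x => ?_)
  have : 0 < 1 + L x := by linarith [h0 x]
  simp only [smul_eq_mul]
  rw [ENNReal.toReal_ofReal this.le, mul_div_cancel₀ _ this.ne']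

/-- Total variation bound for a mixture of densities, by the second moment of a sub-mixture. -/
theorem tvDist_mixture_le {X ι : Type*} [MeasurableSpace X] (μ : Measure X)
    [IsProbabilityMeasure μ] (Om G : Finset ι) (hG : G ⊆ Om) (hne : G.Nonempty)
    (f : ι → X → ℝ) (hm : ∀ i, Measurable (f i)) (h0 : ∀ i x, 0 ≤ f i x)
    (h1 : ∀ i, ∫ x, f i x ∂μ = 1) (h2 : ∀ i j, Integrable (fun x => f i x * f j x) μ)
    (t : ℝ) (ht : 0 < t)
    (hsec : ∑ i ∈ G, ∑ j ∈ G, ∫ x, f i x * f j x ∂μ ≤ (1 + t ^ 2) * (G.card : ℝ) ^ 2) :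
    tvDist μ (μ.withDensity fun x => ENNReal.ofReal ((Om.card : ℝ)⁻¹ * ∑ i ∈ Om, f i x))
      ≤ t / 2 + (1 - (G.card : ℝ) / Om.card) := by
  have hint : ∀ i, Integrable (f i) μ := fun i => by
    by_contra h
    have := h1 i
    rw [integral_undef h] at this
    norm_num at this
  have hGc : (0 : ℝ) < G.card := by exact_mod_cast hne.card_pos
  have hOc : (0 : ℝ) < Om.card := by exact_mod_cast (hne.mono hG).card_pos
  have hGO : (G.card : ℝ) ≤ Om.card := by exact_mod_cast Finset.card_le_card hG
  have hsumi : ∀ s : Finset ι, Integrable (fun x => ∑ i ∈ s, f i x) μ := fun s =>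
    integrable_finsetSum _ fun i _ => hint i
  rw [tvDist_withDensity]
  rotate_left
  · exact (Finset.measurable_sum _ fun i _ => hm i).const_mul _
  · exact fun x => mul_nonneg (by positivity) (Finset.sum_nonneg fun i _ => h0 i x)
  · exact (hsumi Om).const_mul _
  classical
  set g : X → ℝ := fun x => (G.card : ℝ)⁻¹ * ∑ i ∈ G, f i x with hg
  have hgi : Integrable g μ := (hsumi G).const_mul _
  have hgint : ∫ x, g x ∂μ = 1 := by
    rw [hg, integral_const_mul, integral_finsetSum _ fun i _ => hint i]
    simp [h1, hGc.ne']
  have hg2 : (fun x => g x ^ 2)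
      = fun x => ((G.card : ℝ) ^ 2)⁻¹ * ∑ i ∈ G, ∑ j ∈ G, f i x * f j x := by
    funext x
    rw [hg]
    simp only [mul_pow, inv_pow]
    rw [sq (∑ i ∈ G, f i x), Finset.sum_mul_sum]
  have hg2i : Integrable (fun x => g x ^ 2) μ := by
    rw [hg2]
    exact (integrable_finsetSum _ fun i _ => integrable_finsetSum _ fun j _ => h2 i j).const_mul _
  have hg2int : ∫ x, g x ^ 2 ∂μ ≤ 1 + t ^ 2 := by
    rw [hg2, integral_const_mul,
      integral_finsetSum _ fun i _ => integrable_finsetSum _ fun j _ => h2 i j]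
    simp_rw [integral_finsetSum _ fun j _ => h2 _ j]
    rw [inv_mul_le_iff₀ (by positivity), mul_comm]
    exact hsec
  have h8 : ∀ x, (Om.card : ℝ)⁻¹ * ∑ i ∈ G, f i x = (G.card : ℝ) / Om.card * g x := by
    intro x
    rw [hg]
    field_simp
  have h7 : ∀ x, 0 ≤ g x := fun x =>
    mul_nonneg (by positivity) (Finset.sum_nonneg fun i _ => h0 i x)
  clear_value g
  -- Instead of Cauchy–Schwarz, the pointwise bound `|1 - g| ≤ t / 2 + (1 - g)² / (2 t)`; the mean
  -- of `(1 - g)²` is at most `t²`.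
  have hA : ∫ x, |1 - g x| ∂μ ≤ t := by
    have hb : ∀ x, |1 - g x| ≤ t / 2 + (1 - 2 * g x + g x ^ 2) * (1 / (2 * t)) := by
      intro x
      have h3 : 0 ≤ (t - |1 - g x|) ^ 2 / (2 * t) := by positivity
      have h4 : (t - |1 - g x|) ^ 2 / (2 * t)
          = t / 2 + (1 - 2 * g x + g x ^ 2) * (1 / (2 * t)) - |1 - g x| := by
        rw [sub_sq, sq_abs]
        field_simp
        ring
      linarith
    have hi0 : Integrable (fun x => 1 - 2 * g x) μ := (integrable_const _).sub (hgi.const_mul 2)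
    have hi1 : Integrable (fun x => 1 - 2 * g x + g x ^ 2) μ := hi0.add hg2i
    calc ∫ x, |1 - g x| ∂μ
        ≤ ∫ x, (t / 2 + (1 - 2 * g x + g x ^ 2) * (1 / (2 * t))) ∂μ :=
          integral_mono ((integrable_const _).sub hgi).abs
            ((integrable_const _).add (hi1.mul_const _)) hb
      _ = t / 2 + (1 - 2 * 1 + ∫ x, g x ^ 2 ∂μ) * (1 / (2 * t)) := by
          rw [integral_add (integrable_const _) (hi1.mul_const _), integral_mul_const,
            integral_add hi0 hg2i,
            integral_sub (integrable_const _) (hgi.const_mul 2), integral_const_mul, hgint]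
          simp
      _ ≤ t / 2 + (1 - 2 * 1 + (1 + t ^ 2)) * (1 / (2 * t)) := by gcongr
      _ = t := by field_simp; ring
  -- The difference of the two mixtures is `(1 - |G| / |Om|) g` minus the discarded terms, and both
  -- parts have mass `1 - |G| / |Om|`.
  have hB : ∫ x, |g x - (Om.card : ℝ)⁻¹ * ∑ i ∈ Om, f i x| ∂μ
      ≤ 2 * (1 - (G.card : ℝ) / Om.card) := by
    have hb : ∀ x, |g x - (Om.card : ℝ)⁻¹ * ∑ i ∈ Om, f i x| ≤
        (1 - (G.card : ℝ) / Om.card) * g x + (Om.card : ℝ)⁻¹ * ∑ i ∈ Om \ G, f i x := by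
      intro x
      have h5 := Finset.sum_sdiff hG (f := fun i => f i x)
      have h6 : 0 ≤ ∑ i ∈ Om \ G, f i x := Finset.sum_nonneg fun i _ => h0 i x
      have h9 : 0 ≤ 1 - (G.card : ℝ) / Om.card := by
        rw [sub_nonneg, div_le_one hOc]; exact hGO
      have h10 : 0 ≤ (1 - (G.card : ℝ) / Om.card) * g x := mul_nonneg h9 (h7 x)
      have h11 : 0 ≤ (Om.card : ℝ)⁻¹ * ∑ i ∈ Om \ G, f i x := by positivity
      rw [← h5, mul_add, h8 x, abs_le]
      constructor <;> linarith
    calc _ ≤ ∫ x, ((1 - (G.card : ℝ) / Om.card) * g x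
              + (Om.card : ℝ)⁻¹ * ∑ i ∈ Om \ G, f i x) ∂μ :=
          integral_mono (hgi.sub ((hsumi Om).const_mul _)).abs
            ((hgi.const_mul _).add ((hsumi _).const_mul _)) hb
      _ = _ := by
          rw [integral_add (hgi.const_mul _) ((hsumi _).const_mul _), integral_const_mul,
            integral_const_mul, hgint, integral_finsetSum _ fun i _ => hint i]
          simp only [h1, Finset.sum_const, nsmul_eq_mul, mul_one, Finset.card_sdiff_of_subset hG]
          rw [Nat.cast_sub (Finset.card_le_card hG)]
          field_simp
          ring
  have hi1 : Integrable (fun x => |1 - g x|) μ := ((integrable_const _).sub hgi).abs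
  have hi2 : Integrable (fun x => |g x - (Om.card : ℝ)⁻¹ * ∑ i ∈ Om, f i x|) μ :=
    (hgi.sub ((hsumi Om).const_mul _)).abs
  have hC : ∫ x, |1 - (Om.card : ℝ)⁻¹ * ∑ i ∈ Om, f i x| ∂μ ≤
      ∫ x, (|1 - g x| + |g x - (Om.card : ℝ)⁻¹ * ∑ i ∈ Om, f i x|) ∂μ :=
    integral_mono ((integrable_const _).sub ((hsumi Om).const_mul _)).abs
      (hi1.add hi2) fun x => abs_sub_le _ _ _
  rw [integral_add hi1 hi2] at hC
  linarith

/-- A product measure is determined by boxes; on a box the indicator factors over the coordinates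
and Fubini applies to the restricted densities. -/
theorem pi_withDensity_ofReal {ι : Type*} [Fintype ι] (μ : Measure ℝ) [IsProbabilityMeasure μ]
    (f : ι → ℝ → ℝ) (h0 : ∀ p x, 0 ≤ f p x)
    (hi : ∀ p, Integrable (f p) μ) :
    Measure.pi (fun p => μ.withDensity fun x => ENNReal.ofReal (f p x)) =
      (Measure.pi fun _ : ι => μ).withDensity fun x => ENNReal.ofReal (∏ p, f p (x p)) := by
  have hfin : ∀ p, IsFiniteMeasure (μ.withDensity fun x => ENNReal.ofReal (f p x)) := fun p =>
    isFiniteMeasure_withDensity_ofReal (hi p).2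
  refine Measure.pi_eq fun s hs => ?_
  have hind : ∀ x : ι → ℝ, (Set.univ.pi s).indicator (fun x => ∏ p, f p (x p)) x
      = ∏ p, (s p).indicator (f p) (x p) := by
    classical
    intro x
    by_cases hx : x ∈ Set.univ.pi s
    · rw [Set.indicator_of_mem hx]
      exact Finset.prod_congr rfl fun p _ => (Set.indicator_of_mem (hx p trivial) _).symm
    · rw [Set.indicator_of_notMem hx]
      simp only [Set.mem_pi, Set.mem_univ, true_imp_iff, not_forall] at hx
      obtain ⟨p, hp⟩ := hx
      exact (Finset.prod_eq_zero (Finset.mem_univ p) (Set.indicator_of_notMem hp _)).symm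
  have hpi : Integrable (fun x : ι → ℝ => ∏ p, (s p).indicator (f p) (x p))
      (Measure.pi fun _ : ι => μ) :=
    Integrable.fintype_prod fun p => (hi p).indicator (hs p)
  rw [withDensity_apply _ (MeasurableSet.univ_pi hs), ← lintegral_indicator (MeasurableSet.univ_pi hs)]
  have e1 : ∀ x : ι → ℝ,
      (Set.univ.pi s).indicator (fun x => ENNReal.ofReal (∏ p, f p (x p))) x
        = ENNReal.ofReal (∏ p, (s p).indicator (f p) (x p)) := by
    intro x
    rw [← hind]
    by_cases hx : x ∈ Set.univ.pi s <;> simp [hx]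
  simp_rw [e1]
  rw [← ofReal_integral_eq_lintegral_ofReal hpi (Eventually.of_forall fun x =>
    Finset.prod_nonneg fun p _ => Set.indicator_nonneg (fun _ _ => h0 p _) _),
    integral_fintype_prod_eq_prod, ENNReal.ofReal_prod_of_nonneg fun p _ =>
      integral_nonneg fun x => Set.indicator_nonneg (fun _ _ => h0 p _) _]
  refine Finset.prod_congr rfl fun p _ => ?_
  rw [withDensity_apply _ (hs p), ofReal_integral_eq_lintegral_ofReal ((hi p).indicator (hs p))
    (Eventually.of_forall fun x => Set.indicator_nonneg (fun _ _ => h0 p _) _),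
    ← lintegral_indicator (hs p)]
  refine lintegral_congr fun x => ?_
  by_cases hx : x ∈ s p <;> simp [hx]

/-! ### Labelled placements and their likelihood ratios -/

open Classical in
/-- Ordered placements: `m`-tuples of pairwise disjoint blocks from `𝓑`. -/
def tuples {n k : ℕ} (𝓑 : Finset (Block n k)) (m : ℕ) : Finset (Fin m → Block n k) :=
  Finset.univ.filter fun ω =>
    (∀ i, ω i ∈ 𝓑) ∧ ∀ i j, i ≠ j → Disjoint (ω i).entries (ω j).entries

/-- The set of planted entries of a tuple of blocks. -/
def planted {n k m : ℕ} (ω : Fin m → Block n k) : Finset (Fin n × Fin n) :=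
  Finset.univ.biUnion fun i => (ω i).entries

theorem mem_tuples {n k m : ℕ} {𝓑 : Finset (Block n k)} {ω : Fin m → Block n k} :
    ω ∈ tuples 𝓑 m ↔
      (∀ i, ω i ∈ 𝓑) ∧ ∀ i j, i ≠ j → Disjoint (ω i).entries (ω j).entries := by
  simp [tuples]

theorem mem_planted {n k m : ℕ} {ω : Fin m → Block n k} {p : Fin n × Fin n} :
    p ∈ planted ω ↔ ∃ i, p ∈ (ω i).entries := by
  simp [planted]

theorem card_entries {n k : ℕ} (B : Block n k) : B.entries.card = k ^ 2 := by
  rw [Block.entries, Finset.card_product, B.1.2, B.2.2, sq]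

theorem entries_nonempty {n k : ℕ} (hk : 1 ≤ k) (B : Block n k) : B.entries.Nonempty := by
  rw [← Finset.card_pos, card_entries]
  positivity

theorem eq_of_mem_entries {n k m : ℕ} {𝓑 : Finset (Block n k)} {ω : Fin m → Block n k}
    (hω : ω ∈ tuples 𝓑 m) {i j : Fin m} {p : Fin n × Fin n} (hi : p ∈ (ω i).entries)
    (hj : p ∈ (ω j).entries) : i = j := by
  by_contra h
  exact Finset.disjoint_left.mp ((mem_tuples.mp hω).2 i j h) hi hj

theorem injective_of_mem_tuples {n k m : ℕ} (hk : 1 ≤ k) {𝓑 : Finset (Block n k)}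
    {ω : Fin m → Block n k} (hω : ω ∈ tuples 𝓑 m) : Function.Injective ω := by
  intro i j hij
  obtain ⟨p, hp⟩ := entries_nonempty hk (ω i)
  exact eq_of_mem_entries hω hp (hij ▸ hp)

theorem card_planted {n k m : ℕ} {𝓑 : Finset (Block n k)} {ω : Fin m → Block n k}
    (hω : ω ∈ tuples 𝓑 m) : (planted ω).card = m * k ^ 2 := by
  rw [planted, Finset.card_biUnion fun i _ j _ h => (mem_tuples.mp hω).2 i j h]
  simp [card_entries]

open Classical in
-- The pair `(K, β)` is the same datum as the tuple listing the block with label `l` in position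
-- `l`. The assumption `1 ≤ k` matters: only nonempty disjoint blocks are automatically distinct.
theorem sum_placements {n k m : ℕ} (hk : 1 ≤ k) (𝓑 : Finset (Block n k)) {M : Type*}
    [AddCommMonoid M] (f : (Fin m → Block n k) → M) :
    ∑ K ∈ placements 𝓑 m, ∑ β : {B // B ∈ K} ≃ Fin m, f (fun l => (β.symm l).1)
      = ∑ ω ∈ tuples 𝓑 m, f ω := by
  rw [Finset.sum_sigma']
  refine Finset.sum_bij (fun a _ => fun l => (a.2.symm l).1) ?_ ?_ ?_ (fun _ _ => rfl)
  · rintro ⟨K, β⟩ h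
    simp only [Finset.mem_sigma, placements, Finset.mem_filter, Finset.mem_powersetCard,
      Finset.mem_univ, and_true] at h
    rw [mem_tuples]
    refine ⟨fun i => h.1.1 (β.symm i).2, fun i j hij => ?_⟩
    refine h.2 (β.symm i).2 (β.symm j).2 fun heq => hij ?_
    exact β.symm.injective (Subtype.ext heq)
  · rintro ⟨K, β⟩ _ ⟨K', β'⟩ _ heq
    simp only at heq
    have hr : ∀ (K : Finset (Block n k)) (β : {B // B ∈ K} ≃ Fin m),
        K = Finset.univ.image fun l => (β.symm l).1 := by
      intro K β
      ext B
      simp only [Finset.mem_image, Finset.mem_univ, true_and]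
      constructor
      · exact fun hB => ⟨β ⟨B, hB⟩, by simp⟩
      · rintro ⟨l, rfl⟩
        exact (β.symm l).2
    have hK : K = K' := by rw [hr K β, hr K' β', heq]
    subst hK
    congr 1
    have : β.symm = β'.symm := Equiv.ext fun l => Subtype.ext (congrFun heq l)
    exact Equiv.symm_bijective.injective this
  · intro ω hω
    have hinj := injective_of_mem_tuples hk hω
    have hω' := mem_tuples.mp hω
    let β : Fin m ≃ {B // B ∈ Finset.univ.image ω} :=
      Equiv.ofBijective (fun l => ⟨ω l, Finset.mem_image_of_mem _ (Finset.mem_univ l)⟩)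
        ⟨fun i j h => hinj (Subtype.ext_iff.mp h), by
          rintro ⟨B, hB⟩
          obtain ⟨l, -, rfl⟩ := Finset.mem_image.mp hB
          exact ⟨l, rfl⟩⟩
    refine ⟨⟨Finset.univ.image ω, β.symm⟩, ?_, rfl⟩
    simp only [Finset.mem_sigma, placements, Finset.mem_filter, Finset.mem_powersetCard,
      Finset.mem_univ, and_true]
    refine ⟨⟨?_, ?_⟩, ?_⟩
    · intro B hB
      obtain ⟨l, -, rfl⟩ := Finset.mem_image.mp hB
      exact hω'.1 l
    · rw [Finset.card_image_of_injective _ hinj, Finset.card_univ, Fintype.card_fin]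
    · intro A hA B hB hAB
      simp only [Finset.coe_image, Finset.coe_univ, Set.image_univ, Set.mem_range] at hA hB
      obtain ⟨i, rfl⟩ := hA
      obtain ⟨j, rfl⟩ := hB
      exact hω'.2 i j fun h => hAB (h ▸ rfl)

/-- The templates `P` have densities `r` with respect to the standard normal law, all of whose
correlations are at most `e ^ lam`. -/
structure CorrelationBound {k m : ℕ} (P : Fin m → Fin k × Fin k → Measure ℝ)
    (r : Fin m → Fin k × Fin k → ℝ → ℝ) (lam : ℝ) : Prop where
  measurable : ∀ l u, Measurable (r l u)
  nonneg : ∀ l u x, 0 ≤ r l u x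
  law : ∀ l u, P l u = stdNormal.withDensity fun x => ENNReal.ofReal (r l u x)
  integral_eq_one : ∀ l u, ∫ x, r l u x ∂stdNormal = 1
  integrable_mul : ∀ l u l' u', Integrable (fun x => r l u x * r l' u' x) stdNormal
  integral_mul_le : ∀ l u l' u', ∫ x, r l u x * r l' u' x ∂stdNormal ≤ Real.exp lam

instance : IsProbabilityMeasure stdNormal := by unfold stdNormal; infer_instance

instance (n : ℕ) : IsProbabilityMeasure (nullLaw n) := by unfold nullLaw; infer_instance

open Classical in
/-- The density of the entry at `p` with respect to the standard normal law. -/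
noncomputable def entryDensity {n k m : ℕ} (r : Fin m → Fin k × Fin k → ℝ → ℝ) (ω : Fin m → Block n k)
    (p : Fin n × Fin n) : ℝ → ℝ :=
  if h : ∃ i, p ∈ (ω i).entries then
    r h.choose ((ω h.choose).coord p h.choose_spec)
  else fun _ => 1

section

variable {n k m : ℕ} {P : Fin m → Fin k × Fin k → Measure ℝ}
  {r : Fin m → Fin k × Fin k → ℝ → ℝ} {lam : ℝ}

theorem entryDensity_of_mem {ω : Fin m → Block n k} {p : Fin n × Fin n} (hp : p ∈ planted ω) :
    ∃ l u, entryDensity r ω p = r l u := by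
  rw [mem_planted] at hp
  rw [entryDensity, dif_pos hp]
  exact ⟨_, _, rfl⟩

theorem entryDensity_of_notMem {ω : Fin m → Block n k} {p : Fin n × Fin n}
    (hp : p ∉ planted ω) : entryDensity r ω p = fun _ => 1 := by
  rw [mem_planted] at hp
  rw [entryDensity, dif_neg hp]

theorem CorrelationBound.integrable (h : CorrelationBound P r lam) (l : Fin m)
    (u : Fin k × Fin k) : Integrable (r l u) stdNormal := by
  by_contra hn
  have := h.integral_eq_one l u
  rw [integral_undef hn] at this
  norm_num at this

theorem CorrelationBound.entryDensity_props (h : CorrelationBound P r lam)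
    (ω : Fin m → Block n k) (p : Fin n × Fin n) :
    Measurable (entryDensity r ω p) ∧ (∀ x, 0 ≤ entryDensity r ω p x) ∧
      ∫ x, entryDensity r ω p x ∂stdNormal = 1 ∧ Integrable (entryDensity r ω p) stdNormal := by
  by_cases hp : p ∈ planted ω
  · obtain ⟨l, u, e⟩ := entryDensity_of_mem (r := r) hp
    rw [e]
    exact ⟨h.measurable l u, h.nonneg l u, h.integral_eq_one l u, h.integrable l u⟩
  · rw [entryDensity_of_notMem hp]
    exact ⟨measurable_const, fun _ => zero_le_one, by simp, integrable_const _⟩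

/-- Off a planted set the density is constantly 1, so off the common planted set the product
integrates to 1. At a common entry the two labels and positions are unrelated, which is why
`CorrelationBound` ranges over all pairs. -/
theorem CorrelationBound.entryDensity_mul (h : CorrelationBound P r lam)
    (ω ω' : Fin m → Block n k) (p : Fin n × Fin n) :
    Integrable (fun x => entryDensity r ω p x * entryDensity r ω' p x) stdNormal ∧
      ∫ x, entryDensity r ω p x * entryDensity r ω' p x ∂stdNormal
        ≤ if p ∈ planted ω ∩ planted ω' then Real.exp lam else 1 := by
  obtain ⟨-, -, i1, i2⟩ := h.entryDensity_props ω p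
  obtain ⟨-, -, j1, j2⟩ := h.entryDensity_props ω' p
  by_cases hp : p ∈ planted ω
  · by_cases hp' : p ∈ planted ω'
    · obtain ⟨l, u, e⟩ := entryDensity_of_mem (r := r) hp
      obtain ⟨l', u', e'⟩ := entryDensity_of_mem (r := r) hp'
      rw [e, e', if_pos (Finset.mem_inter.mpr ⟨hp, hp'⟩)]
      exact ⟨h.integrable_mul l u l' u', h.integral_mul_le l u l' u'⟩
    · rw [entryDensity_of_notMem hp', if_neg (by simp [hp'])]
      simpa using ⟨i2, i1.le⟩
  · rw [entryDensity_of_notMem hp, if_neg (by simp [hp])]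
    simpa using ⟨j2, j1.le⟩

theorem CorrelationBound.entryLaw_eq (h : CorrelationBound P r lam) {𝓑 : Finset (Block n k)}
    {K : Finset (Block n k)} (β : {B // B ∈ K} ≃ Fin m)
    (hω : (fun l => (β.symm l).1) ∈ tuples 𝓑 m) (p : Fin n × Fin n) :
    entryLaw P K β p = stdNormal.withDensity fun x =>
      ENNReal.ofReal (entryDensity r (fun l => (β.symm l).1) p x) := by
  unfold entryLaw entryDensity
  by_cases hex : ∃ B : {B // B ∈ K}, p ∈ B.1.entries
  · have hex' : ∃ i, p ∈ ((β.symm i).1).entries := ⟨β hex.choose, by simpa using hex.choose_spec⟩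
    rw [dif_pos hex, dif_pos hex', h.law]
    -- The two definitions choose a block through `p` independently; disjointness makes that block
    -- unique.
    have hi : hex'.choose = β hex.choose :=
      eq_of_mem_entries hω (p := p) hex'.choose_spec (by simpa using hex.choose_spec)
    have key : ∀ (i : Fin m) (B : {B // B ∈ K}) (hi : p ∈ ((β.symm i).1).entries)
        (hB : p ∈ B.1.entries), i = β B →
        r (β B) (B.1.coord p hB) = r i ((β.symm i).1.coord p hi) := by
      rintro i B hi hB rfl
      congr 1
      have : ∀ (B' : {B // B ∈ K}) (h' : p ∈ B'.1.entries), B = B' →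
          B.1.coord p hB = B'.1.coord p h' := by
        rintro B' h' rfl
        rfl
      exact this _ hi (by simp)
    rw [key hex'.choose hex.choose hex'.choose_spec hex.choose_spec hi]
  · have hex' : ¬ ∃ i, p ∈ ((β.symm i).1).entries := by
      rintro ⟨i, hi⟩
      exact hex ⟨β.symm i, hi⟩
    rw [dif_neg hex, dif_neg hex']
    simp

/-- The likelihood ratio of the product law planted along `ω`. -/
noncomputable def likelihood (r : Fin m → Fin k × Fin k → ℝ → ℝ) (ω : Fin m → Block n k)
    (x : Fin n × Fin n → ℝ) : ℝ :=
  ∏ p, entryDensity r ω p (x p)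

open Classical in
theorem CorrelationBound.altLaw_eq (h : CorrelationBound P r lam) (hk : 1 ≤ k)
    (𝓑 : Finset (Block n k)) :
    altLaw 𝓑 P = (nullLaw n).withDensity fun x =>
      ENNReal.ofReal (((tuples 𝓑 m).card : ℝ)⁻¹ * ∑ ω ∈ tuples 𝓑 m, likelihood r ω x) := by
  have hmeas : ∀ ω : Fin m → Block n k, Measurable (likelihood r ω) := fun ω =>
    Finset.measurable_fun_prod _ fun p _ =>
      (h.entryDensity_props ω p).1.comp (measurable_pi_apply p)
  have hnn : ∀ (ω : Fin m → Block n k) x, 0 ≤ likelihood r ω x := fun ω x =>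
    Finset.prod_nonneg fun p _ => (h.entryDensity_props ω p).2.1 _
  have hcardβ : ∀ K ∈ placements 𝓑 m, Fintype.card ({B // B ∈ K} ≃ Fin m) = m.factorial := by
    intro K hK
    simp only [placements, Finset.mem_filter, Finset.mem_powersetCard] at hK
    have e : {B // B ∈ K} ≃ Fin m := Fintype.equivFinOfCardEq (by simp [hK.1.2])
    rw [Fintype.card_equiv e, Fintype.card_coe, hK.1.2]
  have hcard : (tuples 𝓑 m).card = (placements 𝓑 m).card * m.factorial := by
    have := sum_placements (m := m) hk 𝓑 (fun _ => (1 : ℕ))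
    simp only [Finset.sum_const, smul_eq_mul, mul_one] at this
    rw [← this, ← smul_eq_mul, ← Finset.sum_const]
    exact Finset.sum_congr rfl fun K hK => by rw [← hcardβ K hK, Finset.card_univ]
  have hpi : ∀ ω : Fin m → Block n k,
      Measure.pi (fun p => stdNormal.withDensity fun x =>
        ENNReal.ofReal (entryDensity r ω p x)) =
      (nullLaw n).withDensity fun x => ENNReal.ofReal (likelihood r ω x) := fun ω =>
    pi_withDensity_ofReal stdNormal _ (fun p => (h.entryDensity_props ω p).2.1)
      fun p => (h.entryDensity_props ω p).2.2.2
  have h1 : altLaw 𝓑 P = ((tuples 𝓑 m).card : ℝ≥0∞)⁻¹ • ∑ ω ∈ tuples 𝓑 m,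
      (nullLaw n).withDensity fun x => ENNReal.ofReal (likelihood r ω x) := by
    rw [← sum_placements hk, altLaw, hcard, Nat.cast_mul,
      ENNReal.mul_inv (Or.inr (by simp)) (Or.inl (by simp)), mul_smul]
    congr 1
    rw [Finset.smul_sum]
    refine Finset.sum_congr rfl fun K hK => ?_
    rw [hcardβ K hK]
    congr 1
    refine Finset.sum_congr rfl fun β _ => ?_
    rw [← hpi]
    congr 1
    funext p
    refine h.entryLaw_eq (𝓑 := 𝓑) β ?_ p
    simp only [placements, Finset.mem_filter, Finset.mem_powersetCard] at hK
    rw [mem_tuples]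
    refine ⟨fun i => hK.1.1 (β.symm i).2, fun i j hij => ?_⟩
    refine hK.2 (β.symm i).2 (β.symm j).2 fun heq => hij ?_
    exact β.symm.injective (Subtype.ext heq)
  have h2 : ∀ s : Finset (Fin m → Block n k), ∑ ω ∈ s, (nullLaw n).withDensity (fun x =>
      ENNReal.ofReal (likelihood r ω x)) =
      (nullLaw n).withDensity fun x => ENNReal.ofReal (∑ ω ∈ s, likelihood r ω x) := by
    intro s
    induction s using Finset.induction_on with
    | empty => simp
    | insert a s ha ih =>
      rw [Finset.sum_insert ha, ih, ← withDensity_add_left (by have := hmeas a; fun_prop)]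
      congr 1
      funext x
      simp only [Pi.add_apply]
      rw [Finset.sum_insert ha, ENNReal.ofReal_add (hnn a x)
        (Finset.sum_nonneg fun ω _ => hnn ω x)]
  rw [h1, h2]
  -- Without placements the scalar is `⊤` on the left and `0` on the right, but the sums are empty
  -- and both sides are the zero measure.
  by_cases h0 : (tuples 𝓑 m).card = 0
  · rw [Finset.card_eq_zero] at h0
    simp [h0]
  rw [← withDensity_smul' _ _ (by simpa using h0)]
  congr 1
  funext x
  simp only [Pi.smul_apply, smul_eq_mul]
  rw [ENNReal.ofReal_mul (by positivity), ENNReal.ofReal_inv_of_pos (by positivity)]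
  simp

/-- The second moment method, restricted to a set `G` of ordered placements. -/
theorem CorrelationBound.tvDist_le (h : CorrelationBound P r lam) (hk : 1 ≤ k)
    (𝓑 : Finset (Block n k)) (G : Finset (Fin m → Block n k)) (hG : G ⊆ tuples 𝓑 m)
    (hne : G.Nonempty) (t : ℝ) (ht : 0 < t)
    (hsec : ∑ ω ∈ G, ∑ ω' ∈ G, Real.exp (lam * (planted ω ∩ planted ω').card)
      ≤ (1 + t ^ 2) * (G.card : ℝ) ^ 2) :
    tvDist (nullLaw n) (altLaw 𝓑 P)
      ≤ t / 2 + (1 - (G.card : ℝ) / (tuples 𝓑 m).card) := by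
  rw [h.altLaw_eq hk]
  refine tvDist_mixture_le (nullLaw n) (tuples 𝓑 m) G hG hne (likelihood r)
    (fun ω => Finset.measurable_fun_prod _ fun p _ =>
      (h.entryDensity_props ω p).1.comp (measurable_pi_apply p))
    (fun ω x => Finset.prod_nonneg fun p _ => (h.entryDensity_props ω p).2.1 _) ?_ ?_ t ht
    (le_trans ?_ hsec)
  · intro ω
    unfold likelihood nullLaw
    rw [integral_fintype_prod_eq_prod]
    exact Finset.prod_eq_one fun p _ => (h.entryDensity_props ω p).2.2.1
  · intro ω ω'
    unfold likelihood nullLaw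
    simp_rw [← Finset.prod_mul_distrib]
    exact Integrable.fintype_prod (f := fun p x => entryDensity r ω p x * entryDensity r ω' p x)
      fun p => (h.entryDensity_mul ω ω' p).1
  · refine Finset.sum_le_sum fun ω _ => Finset.sum_le_sum fun ω' _ => ?_
    unfold likelihood nullLaw
    simp_rw [← Finset.prod_mul_distrib]
    rw [integral_fintype_prod_eq_prod
      (fun p x => entryDensity r ω p x * entryDensity r ω' p x)]
    calc _ ≤ ∏ p, (if p ∈ planted ω ∩ planted ω' then Real.exp lam else 1) :=
          Finset.prod_le_prod (fun p _ => integral_nonneg fun x =>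
            mul_nonneg ((h.entryDensity_props ω p).2.1 _) ((h.entryDensity_props ω' p).2.1 _))
            fun p _ => (h.entryDensity_mul ω ω' p).2
      _ = _ := by
          rw [Finset.prod_ite_mem, Finset.univ_inter, Finset.prod_const, ← Real.exp_nat_mul,
            mul_comm]

end

/-! ### Exponential moments under uniform sampling -/

theorem exp_le_one_add_two_mul {x : ℝ} (h0 : 0 ≤ x) (h1 : x ≤ 1) : Real.exp x ≤ 1 + 2 * x := by
  have := Real.abs_exp_sub_one_sub_id_le (x := x) (by rwa [abs_of_nonneg h0])
  nlinarith [abs_le.mp this]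

/-- Resampling one coordinate at a time: if the conditional mean of `f` at each coordinate, given
all the other coordinates, is at most `C`, then the product of the `f`-values has mean at most
`C` to the number of coordinates. -/
theorem sum_prod_le_of_resampling {ι V : Type*} [Fintype ι] [Fintype V] [DecidableEq ι]
    [DecidableEq V] (Om : Finset (ι → V))
    (f : V → ℝ) (hf : ∀ v, 0 ≤ f v) (C : ℝ) (hC : 0 ≤ C)
    (h : ∀ ω ∈ Om, ∀ x, ∑ v ∈ Finset.univ.filter (fun v => Function.update ω x v ∈ Om), f v
      ≤ C * (Finset.univ.filter fun v => Function.update ω x v ∈ Om).card) :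
    ∑ ω ∈ Om, ∏ x, f (ω x) ≤ Om.card * C ^ Fintype.card ι := by
  suffices hs : ∀ s : Finset ι, ∑ ω ∈ Om, ∏ x ∈ s, f (ω x) ≤ Om.card * C ^ s.card from
    hs Finset.univ
  intro s
  induction s using Finset.induction_on with
  | empty => simp
  | insert a s ha ih =>
    set fib : (ι → V) → Finset V := fun ω =>
      Finset.univ.filter fun v => Function.update ω a v ∈ Om with hfib
    have hmem : ∀ {ω v}, v ∈ fib ω ↔ Function.update ω a v ∈ Om := by
      intro ω v
      simp [hfib]
    have hfibu : ∀ ω v, fib (Function.update ω a v) = fib ω := by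
      intro ω v
      ext w
      rw [hmem, hmem, Function.update_idem]
    have hpos : ∀ ω ∈ Om, (0 : ℝ) < (fib ω).card := by
      intro ω hω
      exact_mod_cast Finset.card_pos.mpr ⟨ω a, by rwa [hmem, Function.update_eq_self]⟩
    set F : (ι → V) → ℝ := fun ω => ∏ x ∈ s, f (ω x) with hF
    have hF0 : ∀ ω, 0 ≤ F ω := fun ω => Finset.prod_nonneg fun x _ => hf _
    have hFu : ∀ ω v, F (Function.update ω a v) = F ω := by
      intro ω v
      refine Finset.prod_congr rfl fun x hx => ?_
      rw [Function.update_of_ne (ne_of_mem_of_not_mem hx ha)]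
    -- Reversibility of resampling: `(ω, v) ↦ (update ω a v, ω a)` is an involution of the pairs
    -- with `v` in the fibre of `ω`, and neither `F` nor the fibre depends on coordinate `a`.
    have key : ∑ ω ∈ Om, F ω * f (ω a)
        = ∑ ω ∈ Om, ∑ v ∈ fib ω, F ω * ((fib ω).card : ℝ)⁻¹ * f v := by
      have e1 : ∑ ω ∈ Om, F ω * f (ω a)
          = ∑ ω ∈ Om, ∑ v ∈ fib ω, F ω * ((fib ω).card : ℝ)⁻¹ * f (ω a) := by
        refine Finset.sum_congr rfl fun ω hω => ?_
        rw [Finset.sum_const, nsmul_eq_mul]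
        have := (hpos ω hω).ne'
        field_simp
      rw [e1, Finset.sum_sigma', Finset.sum_sigma']
      refine Finset.sum_bij' (fun p _ => ⟨Function.update p.1 a p.2, p.1 a⟩)
        (fun p _ => ⟨Function.update p.1 a p.2, p.1 a⟩) ?_ ?_ ?_ ?_ ?_
      · rintro ⟨ω, v⟩ hp
        simp only [Finset.mem_sigma, hmem] at hp ⊢
        simpa using ⟨hp.2, hp.1⟩
      · rintro ⟨ω, v⟩ hp
        simp only [Finset.mem_sigma, hmem] at hp ⊢
        simpa using ⟨hp.2, hp.1⟩
      · rintro ⟨ω, v⟩ hp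
        simp
      · rintro ⟨ω, v⟩ hp
        simp
      · rintro ⟨ω, v⟩ hp
        simp only [hFu, hfibu]
    calc ∑ ω ∈ Om, ∏ x ∈ insert a s, f (ω x) = ∑ ω ∈ Om, F ω * f (ω a) :=
          Finset.sum_congr rfl fun ω _ => by rw [Finset.prod_insert ha, mul_comm]
      _ = ∑ ω ∈ Om, ∑ v ∈ fib ω, F ω * ((fib ω).card : ℝ)⁻¹ * f v := key
      _ ≤ ∑ ω ∈ Om, C * F ω := by
          refine Finset.sum_le_sum fun ω hω => ?_
          have hp := hpos ω hω
          rw [← Finset.mul_sum]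
          calc _ ≤ F ω * ((fib ω).card : ℝ)⁻¹ * (C * (fib ω).card) :=
                mul_le_mul_of_nonneg_left (h ω hω a) (mul_nonneg (hF0 ω) (by positivity))
            _ = C * F ω := by field_simp
      _ ≤ C * (Om.card * C ^ s.card) := by
          rw [← Finset.mul_sum]
          exact mul_le_mul_of_nonneg_left ih hC
      _ = Om.card * C ^ (insert a s).card := by
          rw [Finset.card_insert_of_notMem ha]
          ring

/-- Exponential-type moments of a uniformly random `k`-subset. -/
theorem sum_powersetCard_prod_le {α : Type*} [DecidableEq α] (A : Finset α) (g : α → ℝ)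
    (hg : ∀ a, 0 ≤ g a) (N : ℝ) (hN : 0 < N) (k : ℕ) (hk : N + k ≤ A.card + 1) :
    ∑ S ∈ A.powersetCard k, ∏ a ∈ S, (1 + g a)
      ≤ (A.card.choose k : ℝ) * (1 + (∑ a ∈ A, g a) / N) ^ k := by
  induction k with
  | zero => simp
  | succ k ih =>
    push_cast at hk
    have ih := ih (by linarith)
    have hlt : (k : ℝ) < A.card := by linarith
    have hle : k ≤ A.card := by exact_mod_cast hlt.le
    have hG : 0 ≤ ∑ a ∈ A, g a := Finset.sum_nonneg fun a _ => hg a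
    -- Double counting of pairs `b ∈ S` by removing `b`: a random `(k + 1)`-set is a random `k`-set
    -- with one more point, uniform among `|A| - k ≥ N` candidates.
    have hdc : ((k : ℝ) + 1) * ∑ S ∈ A.powersetCard (k + 1), ∏ a ∈ S, (1 + g a)
        = ∑ S ∈ A.powersetCard k, ∑ b ∈ A \ S, (1 + g b) * ∏ a ∈ S, (1 + g a) := by
      have e1 : ((k : ℝ) + 1) * ∑ S ∈ A.powersetCard (k + 1), ∏ a ∈ S, (1 + g a)
          = ∑ S ∈ A.powersetCard (k + 1), ∑ b ∈ S, ∏ a ∈ S, (1 + g a) := by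
        rw [Finset.mul_sum]
        refine Finset.sum_congr rfl fun S hS => ?_
        rw [Finset.sum_const, (Finset.mem_powersetCard.mp hS).2, nsmul_eq_mul]
        push_cast
        ring
      rw [e1, Finset.sum_sigma', Finset.sum_sigma']
      refine Finset.sum_bij' (fun p _ => ⟨p.1.erase p.2, p.2⟩) (fun p _ => ⟨insert p.2 p.1, p.2⟩)
        ?_ ?_ ?_ ?_ ?_
      · rintro ⟨S, b⟩ hp
        simp only [Finset.mem_sigma, Finset.mem_powersetCard, Finset.mem_sdiff] at hp ⊢
        obtain ⟨⟨h1, h2⟩, h3⟩ := hp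
        exact ⟨⟨(Finset.erase_subset _ _).trans h1, by simp [Finset.card_erase_of_mem h3, h2]⟩,
          h1 h3, Finset.notMem_erase _ _⟩
      · rintro ⟨S, b⟩ hp
        simp only [Finset.mem_sigma, Finset.mem_powersetCard, Finset.mem_sdiff] at hp ⊢
        obtain ⟨⟨h1, h2⟩, h3, h4⟩ := hp
        exact ⟨⟨Finset.insert_subset h3 h1, by simp [Finset.card_insert_of_notMem h4, h2]⟩,
          Finset.mem_insert_self _ _⟩
      · rintro ⟨S, b⟩ hp
        simp only [Finset.mem_sigma] at hp
        simp [Finset.insert_erase hp.2]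
      · rintro ⟨S, b⟩ hp
        simp only [Finset.mem_sigma, Finset.mem_sdiff] at hp
        simp [Finset.erase_insert hp.2.2]
      · rintro ⟨S, b⟩ hp
        simp only [Finset.mem_sigma] at hp
        exact (Finset.mul_prod_erase S (fun a => 1 + g a) hp.2).symm
    have hbound : ∀ S ∈ A.powersetCard k, ∑ b ∈ A \ S, (1 + g b) * ∏ a ∈ S, (1 + g a)
        ≤ ((A.card : ℝ) - k) * (1 + (∑ a ∈ A, g a) / N) * ∏ a ∈ S, (1 + g a) := by
      intro S hS
      rw [Finset.mem_powersetCard] at hS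
      rw [← Finset.sum_mul]
      refine mul_le_mul_of_nonneg_right ?_
        (Finset.prod_nonneg fun a _ => by linarith [hg a])
      rw [Finset.sum_add_distrib, Finset.sum_const, Finset.card_sdiff_of_subset hS.1, hS.2,
        nsmul_eq_mul, mul_one, Nat.cast_sub hle]
      have h1 : ∑ b ∈ A \ S, g b ≤ ∑ a ∈ A, g a :=
        Finset.sum_le_sum_of_subset_of_nonneg Finset.sdiff_subset fun a _ _ => hg a
      have h2 : ∑ a ∈ A, g a ≤ ((A.card : ℝ) - k) * ((∑ a ∈ A, g a) / N) := by
        rw [mul_div_assoc', le_div_iff₀ hN, mul_comm]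
        exact mul_le_mul_of_nonneg_right (by linarith) hG
      linarith
    have hch : ((k : ℝ) + 1) * (A.card.choose (k + 1) : ℝ)
        = ((A.card : ℝ) - k) * A.card.choose k := by
      have := Nat.choose_succ_right_eq A.card k
      rw [← Nat.cast_sub hle]
      exact_mod_cast (by linarith : (k + 1) * A.card.choose (k + 1)
        = (A.card - k) * A.card.choose k)
    have hk1 : (0 : ℝ) < (k : ℝ) + 1 := by positivity
    refine le_of_mul_le_mul_left ?_ hk1
    calc _ ≤ ((A.card : ℝ) - k) * (1 + (∑ a ∈ A, g a) / N) *
            ∑ S ∈ A.powersetCard k, ∏ a ∈ S, (1 + g a) := by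
          rw [hdc, Finset.mul_sum]
          exact Finset.sum_le_sum hbound
      _ ≤ ((A.card : ℝ) - k) * (1 + (∑ a ∈ A, g a) / N) *
            ((A.card.choose k : ℝ) * (1 + (∑ a ∈ A, g a) / N) ^ k) := by
          refine mul_le_mul_of_nonneg_left ih (mul_nonneg (by linarith) (by positivity))
      _ = (((A.card : ℝ) - k) * A.card.choose k) * (1 + (∑ a ∈ A, g a) / N) ^ (k + 1) := by ring
      _ = _ := by rw [← hch]; ring

theorem sum_powersetCard_exp_le {α : Type*} [DecidableEq α] (A : Finset α) (f : α → ℝ)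
    (hf : ∀ a, 0 ≤ f a) (hf1 : ∀ a, f a ≤ 1) (N : ℝ) (hN : 0 < N) (k : ℕ)
    (hk : N + k ≤ A.card + 1) (F : ℝ) (hF : ∑ a ∈ A, f a ≤ F) :
    ∑ S ∈ A.powersetCard k, Real.exp (∑ a ∈ S, f a)
      ≤ (A.card.choose k : ℝ) * Real.exp (2 * k * F / N) := by
  calc _ ≤ ∑ S ∈ A.powersetCard k, ∏ a ∈ S, (1 + 2 * f a) := by
        refine Finset.sum_le_sum fun S _ => ?_
        rw [Real.exp_sum]
        exact Finset.prod_le_prod (fun a _ => (Real.exp_pos _).le)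
          fun a _ => exp_le_one_add_two_mul (hf a) (hf1 a)
    _ ≤ (A.card.choose k : ℝ) * (1 + (∑ a ∈ A, 2 * f a) / N) ^ k :=
        sum_powersetCard_prod_le A _ (fun a => by linarith [hf a]) N hN k hk
    _ ≤ _ := by
        refine mul_le_mul_of_nonneg_left ?_ (by positivity)
        have h0 : 0 ≤ ∑ a ∈ A, f a := Finset.sum_nonneg fun a _ => hf a
        calc (1 + (∑ a ∈ A, 2 * f a) / N) ^ k ≤ (Real.exp (2 * F / N)) ^ k := by
              refine pow_le_pow_left₀ ?_ ?_ k
              · rw [← Finset.mul_sum]; positivity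
              · rw [← Finset.mul_sum, add_comm]
                refine le_trans (Real.add_one_le_exp _) (Real.exp_le_exp.mpr ?_)
                gcongr
          _ = _ := by rw [← Real.exp_nat_mul]; congr 1; ring

/-- Exponential-type moments of a uniformly random permutation, over few coordinates. -/
theorem sum_perm_prod_le {α : Type*} [Fintype α] [DecidableEq α] (g : α → α → ℝ)
    (hg : ∀ a b, 0 ≤ g a b) (N : ℝ) (hN : 0 < N) (s : Finset α)
    (hs : N + s.card ≤ Fintype.card α + 1) :
    ∑ σ : Equiv.Perm α, ∏ a ∈ s, (1 + g a (σ a))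
      ≤ (Fintype.card α).factorial * ∏ a ∈ s, (1 + (∑ b, g a b) / N) := by
  induction s using Finset.induction_on with
  | empty => simp [Fintype.card_perm]
  | insert a s ha ih =>
    rw [Finset.card_insert_of_notMem ha] at hs
    push_cast at hs
    have ih := ih (by linarith)
    set F : Equiv.Perm α → ℝ := fun σ => ∏ x ∈ s, (1 + g x (σ x)) with hF
    have hF0 : ∀ σ, 0 ≤ F σ := fun σ => Finset.prod_nonneg fun x _ => by linarith [hg x (σ x)]
    -- Precomposing with the transposition of `a` and a coordinate `y` outside `s` fixes `F`. So `σ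
    -- a` may be replaced by `σ y` and averaged over the at least `N` such `y`.
    have hsw : ∀ y ∈ sᶜ, ∑ σ, F σ * g a (σ a) = ∑ σ, F σ * g a (σ y) := by
      intro y hy
      rw [Finset.mem_compl] at hy
      rw [← Equiv.sum_comp (Equiv.mulRight (Equiv.swap a y))]
      refine Finset.sum_congr rfl fun σ _ => ?_
      simp only [Equiv.coe_mulRight, Equiv.Perm.mul_apply, Equiv.swap_apply_left, hF]
      congr 1
      refine Finset.prod_congr rfl fun x hx => ?_
      rw [Equiv.swap_apply_of_ne_of_ne (ne_of_mem_of_not_mem hx ha) (ne_of_mem_of_not_mem hx hy)]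
    have hcard : N ≤ (sᶜ.card : ℝ) := by
      rw [Finset.card_compl, Nat.cast_sub (Finset.card_le_univ s)]
      linarith
    have hX0 : 0 ≤ ∑ σ, F σ * g a (σ a) :=
      Finset.sum_nonneg fun σ _ => mul_nonneg (hF0 σ) (hg _ _)
    have hkey : N * ∑ σ, F σ * g a (σ a) ≤ (∑ σ, F σ) * ∑ b, g a b := by
      calc N * ∑ σ, F σ * g a (σ a) ≤ (sᶜ.card : ℝ) * ∑ σ, F σ * g a (σ a) :=
            mul_le_mul_of_nonneg_right hcard hX0
        _ = ∑ y ∈ sᶜ, ∑ σ, F σ * g a (σ y) := by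
            rw [← Finset.sum_congr rfl hsw, Finset.sum_const, nsmul_eq_mul]
        _ ≤ (∑ σ, F σ) * ∑ b, g a b := by
            rw [Finset.sum_comm, Finset.sum_mul]
            refine Finset.sum_le_sum fun σ _ => ?_
            rw [← Finset.mul_sum]
            refine mul_le_mul_of_nonneg_left ?_ (hF0 σ)
            rw [← Equiv.sum_comp σ (fun b => g a b)]
            exact Finset.sum_le_sum_of_subset_of_nonneg (Finset.subset_univ _)
              fun _ _ _ => hg _ _
    calc ∑ σ : Equiv.Perm α, ∏ x ∈ insert a s, (1 + g x (σ x))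
        = ∑ σ, F σ + ∑ σ, F σ * g a (σ a) := by
          rw [← Finset.sum_add_distrib]
          refine Finset.sum_congr rfl fun σ _ => ?_
          rw [Finset.prod_insert ha]
          ring
      _ ≤ ∑ σ, F σ + (∑ σ, F σ) * (∑ b, g a b) / N := by
          gcongr
          rw [le_div_iff₀ hN]
          linarith
      _ = (1 + (∑ b, g a b) / N) * ∑ σ, F σ := by ring
      _ ≤ (1 + (∑ b, g a b) / N) *
            ((Fintype.card α).factorial * ∏ x ∈ s, (1 + (∑ b, g x b) / N)) := by
          refine mul_le_mul_of_nonneg_left ih ?_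
          have : 0 ≤ ∑ b, g a b := Finset.sum_nonneg fun b _ => hg a b
          positivity
      _ = _ := by
          rw [Finset.prod_insert ha]
          ring

/-- Exponential moments of `∑ a, f a (σ a)` for a uniformly random permutation `σ`. -/
theorem sum_perm_exp_le {n : ℕ} (hn : 1 ≤ n) (f : Fin n → Fin n → ℝ) (hf : ∀ a b, 0 ≤ f a b)
    (hf1 : ∀ a b, 2 * f a b ≤ 1) :
    ∑ σ : Equiv.Perm (Fin n), Real.exp (∑ a, f a (σ a))
      ≤ n.factorial * Real.exp (8 / n * ∑ a, ∑ b, f a b) := by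
  have hn0 : (0 : ℝ) < n := by exact_mod_cast hn
  have hhalf : ∀ s : Finset (Fin n), (n : ℝ) / 2 + s.card ≤ n + 1 →
      ∑ σ : Equiv.Perm (Fin n), Real.exp (2 * ∑ a ∈ s, f a (σ a))
        ≤ n.factorial * Real.exp (8 / n * ∑ a, ∑ b, f a b) := by
    intro s hs
    calc _ ≤ ∑ σ : Equiv.Perm (Fin n), ∏ a ∈ s, (1 + 4 * f a (σ a)) := by
          refine Finset.sum_le_sum fun σ _ => ?_
          rw [Finset.mul_sum, Real.exp_sum]
          refine Finset.prod_le_prod (fun a _ => (Real.exp_pos _).le) fun a _ => ?_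
          have := exp_le_one_add_two_mul (x := 2 * f a (σ a)) (by linarith [hf a (σ a)])
            (hf1 _ _)
          linarith
      _ ≤ n.factorial * ∏ a ∈ s, (1 + (∑ b, 4 * f a b) / (n / 2)) := by
          have := sum_perm_prod_le (fun a b => 4 * f a b)
            (fun a b => by linarith [hf a b]) ((n : ℝ) / 2) (by positivity) s
            (by simpa using hs)
          simpa using this
      _ ≤ _ := by
          refine mul_le_mul_of_nonneg_left ?_ (by positivity)
          have h0 : ∀ a, 0 ≤ ∑ b, f a b := fun a => Finset.sum_nonneg fun b _ => hf a b
          calc ∏ a ∈ s, (1 + (∑ b, 4 * f a b) / ((n : ℝ) / 2))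
              ≤ ∏ a ∈ s, Real.exp (8 / n * ∑ b, f a b) := by
                refine Finset.prod_le_prod (fun a _ => ?_) fun a _ => ?_
                · rw [← Finset.mul_sum]
                  have := h0 a
                  positivity
                · rw [← Finset.mul_sum, add_comm]
                  refine le_trans (Real.add_one_le_exp _) (Real.exp_le_exp.mpr (le_of_eq ?_))
                  field_simp
                  ring
            _ = Real.exp (8 / n * ∑ a ∈ s, ∑ b, f a b) := by
                rw [← Real.exp_sum, Finset.mul_sum]
            _ ≤ _ := by
                refine Real.exp_le_exp.mpr (mul_le_mul_of_nonneg_left ?_ (by positivity))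
                exact Finset.sum_le_sum_of_subset_of_nonneg (Finset.subset_univ _)
                  fun a _ _ => h0 a
  -- About half of the coordinates must stay unexposed in `sum_perm_prod_le`, so they are split in
  -- two halves, recombined by `exp (A + B) ≤ (exp (2 A) + exp (2 B)) / 2`. The doubling is the
  -- reason for the hypothesis on `2 * f`.
  obtain ⟨s, -, hs⟩ := Finset.exists_subset_card_eq
    (show n / 2 ≤ (Finset.univ : Finset (Fin n)).card by simpa using Nat.div_le_self n 2)
  have hsc : sᶜ.card = n - n / 2 := by rw [Finset.card_compl, hs, Fintype.card_fin]
  have h1 := hhalf s (by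
    have : 2 * (n / 2) ≤ n := Nat.mul_div_le n 2
    have : (2 : ℝ) * ((n / 2 : ℕ) : ℝ) ≤ n := by exact_mod_cast this
    rw [hs]
    linarith)
  have h2 := hhalf sᶜ (by
    have : 2 * (n - n / 2) ≤ n + 1 := by omega
    have : (2 : ℝ) * ((n - n / 2 : ℕ) : ℝ) ≤ n + 1 := by exact_mod_cast this
    rw [hsc]
    linarith)
  have h3 : ∀ σ : Equiv.Perm (Fin n), Real.exp (∑ a, f a (σ a)) ≤
      (Real.exp (2 * ∑ a ∈ s, f a (σ a)) + Real.exp (2 * ∑ a ∈ sᶜ, f a (σ a))) / 2 := by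
    intro σ
    rw [← Finset.sum_add_sum_compl s, Real.exp_add, two_mul, two_mul, Real.exp_add, Real.exp_add]
    nlinarith [sq_nonneg (Real.exp (∑ a ∈ s, f a (σ a)) - Real.exp (∑ a ∈ sᶜ, f a (σ a)))]
  calc _ ≤ ∑ σ : Equiv.Perm (Fin n), (Real.exp (2 * ∑ a ∈ s, f a (σ a))
            + Real.exp (2 * ∑ a ∈ sᶜ, f a (σ a))) / 2 := Finset.sum_le_sum fun σ _ => h3 σ
    _ ≤ _ := by
        rw [← Finset.sum_div, Finset.sum_add_distrib]
        linarith

/-! ### Overlap moments by resampling blocks -/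

section

variable {n k m : ℕ}

/-- Disjoint blocks make the overlap additive, which gives the product form needed for resampling.
-/
theorem exp_planted_inter {𝓑 : Finset (Block n k)} {ω : Fin m → Block n k}
    (hω : ω ∈ tuples 𝓑 m) (U : Finset (Fin n × Fin n)) (lam : ℝ) :
    Real.exp (lam * (planted ω ∩ U).card)
      = ∏ i, Real.exp (lam * ((ω i).entries ∩ U).card) := by
  have h : (planted ω ∩ U).card = ∑ i, ((ω i).entries ∩ U).card := by
    rw [planted, Finset.biUnion_inter, Finset.card_biUnion]
    intro i _ j _ hij
    exact ((mem_tuples.mp hω).2 i j hij).mono Finset.inter_subset_left Finset.inter_subset_left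
  rw [← Real.exp_sum, h, Nat.cast_sum, Finset.mul_sum]

theorem update_mem_tuples {𝓑 : Finset (Block n k)} {ω : Fin m → Block n k}
    (hω : ω ∈ tuples 𝓑 m) (x : Fin m) (v : Block n k) :
    Function.update ω x v ∈ tuples 𝓑 m ↔
      v ∈ 𝓑 ∧ ∀ j, j ≠ x → Disjoint v.entries (ω j).entries := by
  rw [mem_tuples] at hω ⊢
  constructor
  · rintro ⟨h1, h2⟩
    refine ⟨by simpa using h1 x, fun j hj => ?_⟩
    have := h2 x j (Ne.symm hj)
    rwa [Function.update_self, Function.update_of_ne hj] at this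
  · rintro ⟨h1, h2⟩
    constructor
    · intro i
      by_cases hi : i = x
      · subst hi
        simpa using h1
      · rw [Function.update_of_ne hi]
        exact hω.1 i
    · intro i j hij
      by_cases hi : i = x
      · subst hi
        rw [Function.update_self, Function.update_of_ne (Ne.symm hij)]
        exact h2 j (Ne.symm hij)
      · by_cases hj : j = x
        · subst hj
          rw [Function.update_self, Function.update_of_ne hi]
          exact (h2 i hi).symm
        · rw [Function.update_of_ne hi, Function.update_of_ne hj]
          exact hω.2 i j hij

open Classical in
/-- If each block of `𝓑` meets at most `h` others, a block of a placement can be resampled from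
all but `m * h` elements of `𝓑`. -/
theorem card_le_card_update {𝓑 : Finset (Block n k)} (h : ℕ)
    (hh : ∀ B ∈ 𝓑, (𝓑.filter fun v => ¬ Disjoint v.entries B.entries).card ≤ h)
    {ω : Fin m → Block n k} (hω : ω ∈ tuples 𝓑 m) (x : Fin m) :
    𝓑.card ≤ (Finset.univ.filter fun v => Function.update ω x v ∈ tuples 𝓑 m).card + m * h := by
  have hsub : 𝓑 ⊆ (Finset.univ.filter fun v => Function.update ω x v ∈ tuples 𝓑 m) ∪
      Finset.univ.biUnion fun j => 𝓑.filter fun v => ¬ Disjoint v.entries (ω j).entries := by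
    intro v hv
    by_cases hd : ∀ j, j ≠ x → Disjoint v.entries (ω j).entries
    · refine Finset.mem_union_left _ ?_
      rw [Finset.mem_filter, update_mem_tuples hω]
      exact ⟨Finset.mem_univ _, hv, hd⟩
    · push Not at hd
      obtain ⟨j, -, hj⟩ := hd
      refine Finset.mem_union_right _ (Finset.mem_biUnion.mpr ⟨j, Finset.mem_univ j, ?_⟩)
      exact Finset.mem_filter.mpr ⟨hv, hj⟩
  refine (Finset.card_le_card hsub).trans ((Finset.card_union_le _ _).trans ?_)
  refine Nat.add_le_add_left (Finset.card_biUnion_le.trans ?_) _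
  calc _ ≤ ∑ _j : Fin m, h := Finset.sum_le_sum fun j _ => hh _ ((mem_tuples.mp hω).1 j)
    _ = m * h := by simp

open Classical in
-- `D` bounds the total excess of `exp (lam * overlap)` over 1 on all of `𝓑`. A resampled block is
-- uniform on at least `N` elements of `𝓑`, so its conditional mean is at most `1 + D / N`.
theorem sum_tuples_exp_le {𝓑 : Finset (Block n k)} (U : Finset (Fin n × Fin n)) (lam : ℝ)
    (hlam : 0 ≤ lam) (N D : ℝ) (hN : 0 < N)
    (havail : ∀ ω ∈ tuples 𝓑 m, ∀ x : Fin m,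
      N ≤ (Finset.univ.filter fun v => Function.update ω x v ∈ tuples 𝓑 m).card)
    (hD : ∑ B ∈ 𝓑, (Real.exp (lam * (B.entries ∩ U).card) - 1) ≤ D) :
    ∑ ω ∈ tuples 𝓑 m, Real.exp (lam * (planted ω ∩ U).card)
      ≤ (tuples 𝓑 m).card * Real.exp (m * (D / N)) := by
  set f : Block n k → ℝ := fun B => Real.exp (lam * (B.entries ∩ U).card) with hf
  have hf1 : ∀ B, 0 ≤ f B - 1 := fun B => by
    rw [sub_nonneg]
    exact Real.one_le_exp (by positivity)
  have hD0 : 0 ≤ D := (Finset.sum_nonneg fun B _ => hf1 B).trans hD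
  calc _ = ∑ ω ∈ tuples 𝓑 m, ∏ i, f (ω i) :=
        Finset.sum_congr rfl fun ω hω => exp_planted_inter hω U lam
    _ ≤ (tuples 𝓑 m).card * (Real.exp (D / N)) ^ Fintype.card (Fin m) := by
        refine sum_prod_le_of_resampling _ f (fun v => (Real.exp_pos _).le) _
          (Real.exp_pos _).le fun ω hω x => ?_
        set fib := Finset.univ.filter fun v => Function.update ω x v ∈ tuples 𝓑 m with hfib
        have hsub : fib ⊆ 𝓑 := by
          intro v hv
          rw [hfib, Finset.mem_filter, update_mem_tuples hω] at hv
          exact hv.2.1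
        have hNc : N ≤ fib.card := havail ω hω x
        calc ∑ v ∈ fib, f v = fib.card + ∑ v ∈ fib, (f v - 1) := by
              rw [Finset.sum_sub_distrib]
              simp
          _ ≤ fib.card + D := by
              gcongr
              exact (Finset.sum_le_sum_of_subset_of_nonneg hsub fun B _ _ => hf1 B).trans hD
          _ ≤ fib.card + (D / N) * fib.card := by
              gcongr
              rw [div_mul_eq_mul_div, le_div_iff₀ hN]
              exact mul_le_mul_of_nonneg_left hNc hD0
          _ = (D / N + 1) * fib.card := by ring
          _ ≤ Real.exp (D / N) * fib.card :=
              mul_le_mul_of_nonneg_right (Real.add_one_le_exp _) (by positivity)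
    _ = _ := by rw [Fintype.card_fin, ← Real.exp_nat_mul]

/-! ### Incidence counts for uniform blocks -/

open Classical in
theorem card_filter_mem_subset (r : Fin n) :
    n * (Finset.univ.filter fun S : {S : Finset (Fin n) // S.card = k} => r ∈ S.1).card
      = k * n.choose k := by
  -- The complement is easier to count: sets missing `r` are the `k`-subsets of the remaining `n -
  -- 1` points.
  have h1 : (Finset.univ.filter fun S : {S : Finset (Fin n) // S.card = k} => r ∉ S.1).card
      = (n - 1).choose k := by
    rw [← Finset.card_map (Function.Embedding.subtype _)]
    have : (Finset.univ.filter fun S : {S : Finset (Fin n) // S.card = k} => r ∉ S.1).map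
        (Function.Embedding.subtype _) = (Finset.univ.erase r).powersetCard k := by
      ext S
      simp only [Finset.mem_map, Finset.mem_filter, Finset.mem_univ, true_and,
        Function.Embedding.subtype_apply, Subtype.exists, exists_and_left, exists_prop,
        exists_eq_right_right, Finset.mem_powersetCard, Finset.subset_erase, Finset.subset_univ]
    rw [this, Finset.card_powersetCard, Finset.card_erase_of_mem (Finset.mem_univ r),
      Finset.card_univ, Fintype.card_fin]
  have h2 := Finset.card_filter_add_card_filter_not (s := (Finset.univ :
    Finset {S : Finset (Fin n) // S.card = k})) (fun S => r ∈ S.1)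
  have h3 : (Finset.univ : Finset {S : Finset (Fin n) // S.card = k}).card = n.choose k := by
    rw [Finset.card_univ, Fintype.card_finset_len, Fintype.card_fin]
  rw [h1, h3] at h2
  obtain ⟨N, rfl⟩ : ∃ N, n = N + 1 := ⟨n - 1, by have := r.pos; omega⟩
  have h4 := Nat.choose_mul_succ_eq N k
  rw [Nat.add_sub_cancel] at h2
  by_cases hk : k ≤ N + 1
  · zify [hk] at h2 h4 ⊢
    linear_combination (N + 1 : ℤ) * h2 - h4
  · rw [Nat.choose_eq_zero_of_lt (by omega : N + 1 < k)] at h2 ⊢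
    have : (Finset.univ.filter fun S : {S : Finset (Fin (N + 1)) // S.card = k} => r ∈ S.1).card
      = 0 := by omega
    rw [this, mul_zero, mul_zero]

theorem card_allBlocks : (allBlocks n k).card = n.choose k ^ 2 := by
  rw [allBlocks, Finset.card_univ, Fintype.card_prod, Fintype.card_finset_len, Fintype.card_fin, sq]

open Classical in
theorem card_filter_mem_entries (p : Fin n × Fin n) :
    n ^ 2 * ((allBlocks n k).filter fun B => p ∈ B.entries).card
      = k ^ 2 * (allBlocks n k).card := by
  have : (allBlocks n k).filter (fun B => p ∈ B.entries) =
      (Finset.univ.filter fun S : {S : Finset (Fin n) // S.card = k} => p.1 ∈ S.1) ×ˢ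
      (Finset.univ.filter fun S : {S : Finset (Fin n) // S.card = k} => p.2 ∈ S.1) := by
    ext B
    simp [allBlocks, Block.entries]
  rw [this, Finset.card_product, card_allBlocks]
  linear_combination (n * (Finset.univ.filter fun S : {S : Finset (Fin n) // S.card = k} =>
    p.1 ∈ S.1).card) * card_filter_mem_subset (k := k) p.2
    + k * n.choose k * card_filter_mem_subset (k := k) p.1

open Classical in
theorem sum_card_entries_inter (U : Finset (Fin n × Fin n)) :
    n ^ 2 * ∑ B ∈ allBlocks n k, (B.entries ∩ U).card
      = k ^ 2 * (allBlocks n k).card * U.card := by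
  have h : ∑ B ∈ allBlocks n k, (B.entries ∩ U).card
      = ∑ p ∈ U, ((allBlocks n k).filter fun B => p ∈ B.entries).card := by
    simp_rw [Finset.inter_comm _ U, ← Finset.filter_mem_eq_inter, Finset.card_filter]
    rw [Finset.sum_comm]
  rw [h, Finset.mul_sum, Finset.sum_congr rfl fun p _ => card_filter_mem_entries p,
    Finset.sum_const, smul_eq_mul]
  ring

open Classical in
-- Markov's inequality: the indicator of a meeting is at most the size of the intersection.
theorem card_filter_not_disjoint (B : Block n k) :
    n ^ 2 * ((allBlocks n k).filter fun v => ¬ Disjoint v.entries B.entries).card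
      ≤ k ^ 4 * (allBlocks n k).card := by
  calc _ ≤ n ^ 2 * ∑ v ∈ allBlocks n k, (v.entries ∩ B.entries).card := by
        refine Nat.mul_le_mul_left _ ?_
        rw [Finset.card_filter]
        refine Finset.sum_le_sum fun v _ => ?_
        split_ifs with h
        · exact Nat.zero_le _
        · exact (Finset.not_disjoint_iff_nonempty_inter.mp h).card_pos
    _ = _ := by
        rw [sum_card_entries_inter, card_entries]
        ring

/-- Overlap moment for the non-consecutive family with small blocks and a bounded signal. -/
theorem sum_allBlocks_exp_le_of_small (hk : 1 ≤ k) (hmk : m * k ≤ n)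
    (hsmall : 2 * k ^ 3 ≤ n) (U : Finset (Fin n × Fin n)) (lam : ℝ) (hlam : 0 ≤ lam)
    (hlk : lam * k ^ 2 ≤ 1) :
    ∑ ω ∈ tuples (allBlocks n k) m, Real.exp (lam * (planted ω ∩ U).card)
      ≤ (tuples (allBlocks n k) m).card * Real.exp (4 * lam * m * k ^ 2 * U.card / n ^ 2) := by
  classical
  have hn : 0 < n := by
    have : 1 ≤ k ^ 3 := Nat.one_le_pow _ _ hk
    omega
  have hkn : k ≤ n := by
    have : k ≤ k ^ 3 := Nat.le_self_pow (by norm_num) k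
    omega
  have hn0 : (0 : ℝ) < n := by exact_mod_cast hn
  have hM : (0 : ℝ) < (allBlocks n k).card := by
    rw [card_allBlocks]
    have := Nat.choose_pos hkn
    positivity
  set M : ℝ := ((allBlocks n k).card : ℝ) with hMdef
  have h := sum_tuples_exp_le (m := m) (𝓑 := allBlocks n k) U lam hlam (M / 2)
    (2 * lam * (k ^ 2 * M * U.card / n ^ 2)) (by positivity) ?_ ?_
  · refine h.trans (le_of_eq ?_)
    congr 2
    field_simp
    ring
  · intro ω hω x
    have hh : ∀ B ∈ allBlocks n k,
        ((allBlocks n k).filter fun v => ¬ Disjoint v.entries B.entries).card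
          ≤ k ^ 4 * (allBlocks n k).card / n ^ 2 := by
      intro B _
      rw [Nat.le_div_iff_mul_le (by positivity), mul_comm]
      exact card_filter_not_disjoint B
    have h1 := card_le_card_update _ hh hω x
    have h2 : 2 * (m * (k ^ 4 * (allBlocks n k).card / n ^ 2)) ≤ (allBlocks n k).card := by
      have h3 : k ^ 4 * (allBlocks n k).card / n ^ 2 * n ^ 2 ≤ k ^ 4 * (allBlocks n k).card :=
        Nat.div_mul_le_self _ _
      -- Small blocks enter decisively here: the other blocks together exclude at most the fraction
      -- `m k⁴ / n² ≤ 1 / 2` of all blocks.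
      have h4 : 2 * (m * k ^ 4) ≤ n ^ 2 := by
        calc 2 * (m * k ^ 4) = (m * k) * (2 * k ^ 3) := by ring
          _ ≤ n * n := Nat.mul_le_mul hmk hsmall
          _ = n ^ 2 := (sq n).symm
      refine Nat.le_of_mul_le_mul_right ?_ (show 0 < n ^ 2 by positivity)
      calc _ = 2 * m * (k ^ 4 * (allBlocks n k).card / n ^ 2 * n ^ 2) := by ring
        _ ≤ 2 * m * (k ^ 4 * (allBlocks n k).card) := Nat.mul_le_mul_left _ h3
        _ = (2 * (m * k ^ 4)) * (allBlocks n k).card := by ring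
        _ ≤ n ^ 2 * (allBlocks n k).card := Nat.mul_le_mul_right _ h4
        _ = _ := mul_comm _ _
    have h5 : (allBlocks n k).card ≤ 2 * (Finset.univ.filter fun v =>
        Function.update ω x v ∈ tuples (allBlocks n k) m).card := by omega
    have h6 : M ≤ 2 * ((Finset.univ.filter fun v =>
        Function.update ω x v ∈ tuples (allBlocks n k) m).card : ℝ) := by
      rw [hMdef]
      exact_mod_cast h5
    linarith
  · calc ∑ B ∈ allBlocks n k, (Real.exp (lam * (B.entries ∩ U).card) - 1)
        ≤ ∑ B ∈ allBlocks n k, 2 * lam * ((B.entries ∩ U).card : ℝ) := by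
          refine Finset.sum_le_sum fun B _ => ?_
          have hc : ((B.entries ∩ U).card : ℝ) ≤ k ^ 2 := by
            have := Finset.card_le_card (Finset.inter_subset_left (s₁ := B.entries) (s₂ := U))
            rw [card_entries] at this
            exact_mod_cast this
          have := exp_le_one_add_two_mul (x := lam * (B.entries ∩ U).card) (by positivity)
            ((mul_le_mul_of_nonneg_left hc hlam).trans hlk)
          linarith
      _ = 2 * lam * (k ^ 2 * M * U.card / n ^ 2) := by
          rw [← Finset.mul_sum, hMdef]
          congr 1
          rw [eq_div_iff (by positivity), mul_comm]
          exact_mod_cast sum_card_entries_inter (k := k) U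

/-! ### Resampling rows given columns and columns given rows -/

/-- Exponential moments of a `k`-subset, uniform among those that avoid some of the sets `R j`. -/
theorem sum_avoiding_exp_le (hmk : 2 * (m * k) ≤ n) (hn : 1 ≤ n)
    (R : Fin m → {S : Finset (Fin n) // S.card = k}) (x : Fin m) (q : Fin m → Prop)
    (D : {S : Finset (Fin n) // S.card = k} → Prop) [DecidablePred D]
    (hD : ∀ S, D S ↔ ∀ j, j ≠ x → Disjoint S.1 (R j).1 ∨ q j)
    (f : Fin n → ℝ) (hf : ∀ a, 0 ≤ f a) (hf1 : ∀ a, f a ≤ 1) (F : ℝ) (hF : ∑ a, f a ≤ F) :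
    ∑ S ∈ Finset.univ.filter D, Real.exp (∑ a ∈ S.1, f a)
      ≤ (Finset.univ.filter D).card * Real.exp (4 * k * F / n) := by
  classical
  -- The points not forbidden by any constraining `R j`. The constraint from `j` is void when `q j`
  -- holds, and the admissible sets are exactly the `k`-subsets of `A`.
  set A : Finset (Fin n) := Finset.univ.filter fun r => ∀ j, j ≠ x → r ∈ (R j).1 → q j with hA
  have hmap : (Finset.univ.filter D).map (Function.Embedding.subtype _)
      = A.powersetCard k := by
    ext S
    simp only [Finset.mem_map, Finset.mem_filter, Finset.mem_univ, true_and,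
      Function.Embedding.subtype_apply, Subtype.exists, exists_and_left, exists_prop,
      exists_eq_right_right, Finset.mem_powersetCard, hD]
    refine and_congr_left fun _ => ?_
    constructor
    · intro h r hr
      rw [hA, Finset.mem_filter]
      exact ⟨Finset.mem_univ _, fun j hj hrj => (h j hj).resolve_left
        fun hd => Finset.disjoint_left.mp hd hr hrj⟩
    · intro h j hj
      by_cases hq : q j
      · exact Or.inr hq
      · refine Or.inl (Finset.disjoint_left.mpr fun r hr hrj => hq ?_)
        exact (Finset.mem_filter.mp (h hr)).2 j hj hrj
  -- Only the `m - 1` sets other than the resampled one are excluded. The spare `k` is what leaves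
  -- `n / 2` points free throughout the drawing of `k` points.
  have hcard : n + k ≤ A.card + m * k := by
    have hsub : Aᶜ ⊆ (Finset.univ.erase x).biUnion fun j => (R j).1 := by
      intro r hr
      rw [Finset.mem_compl, hA, Finset.mem_filter] at hr
      push Not at hr
      obtain ⟨j, hj, hrj, -⟩ := hr (Finset.mem_univ r)
      exact Finset.mem_biUnion.mpr ⟨j, Finset.mem_erase.mpr ⟨hj, Finset.mem_univ j⟩, hrj⟩
    have h1 : Aᶜ.card ≤ (m - 1) * k := by
      refine (Finset.card_le_card hsub).trans (Finset.card_biUnion_le.trans ?_)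
      rw [Finset.sum_congr rfl fun j _ => (R j).2, Finset.sum_const,
        Finset.card_erase_of_mem (Finset.mem_univ x), Finset.card_univ, Fintype.card_fin,
        smul_eq_mul]
    have h2 : A.card + Aᶜ.card = n := by rw [Finset.card_add_card_compl, Fintype.card_fin]
    have h3 : (m - 1) * k + k = m * k := by
      have : m - 1 + 1 = m := Nat.sub_add_cancel (by have := x.pos; omega)
      calc _ = (m - 1 + 1) * k := by ring
        _ = _ := by rw [this]
    omega
  have hn0 : (0 : ℝ) < n := by exact_mod_cast hn
  have hc : (Finset.univ.filter D).card = A.card.choose k := by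
    rw [← Finset.card_map (Function.Embedding.subtype _), hmap, Finset.card_powersetCard]
  have hs : ∑ S ∈ Finset.univ.filter D, Real.exp (∑ a ∈ S.1, f a)
      = ∑ S ∈ A.powersetCard k, Real.exp (∑ a ∈ S, f a) := by
    rw [← hmap, Finset.sum_map]
    rfl
  rw [hs, hc]
  refine (sum_powersetCard_exp_le A f hf hf1 ((n : ℝ) / 2) (by positivity) k ?_ F
    ((Finset.sum_le_sum_of_subset_of_nonneg (Finset.subset_univ _) fun a _ _ => hf a).trans
      hF)).trans (le_of_eq ?_)
  · have h1 : (n : ℝ) + k ≤ A.card + m * k := by exact_mod_cast hcard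
    have h2 : 2 * ((m : ℝ) * k) ≤ n := by exact_mod_cast hmk
    linarith
  · congr 2
    field_simp
    ring

theorem sum_card_column (U : Finset (Fin n × Fin n)) :
    ∑ c, ((Finset.univ.filter fun r => (r, c) ∈ U).card : ℝ) = U.card := by
  rw [← Nat.cast_sum]
  congr 1
  rw [Finset.card_eq_sum_card_fiberwise (f := Prod.snd) (t := Finset.univ) (by simp)]
  refine Finset.sum_congr rfl fun c _ => ?_
  refine Finset.card_bij (fun r _ => (r, c)) ?_ ?_ ?_
  · intro r hr
    simpa using hr
  · intro r _ r' _ h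
    simpa using h
  · rintro ⟨r, c'⟩ h
    simp only [Finset.mem_filter] at h
    obtain ⟨h1, rfl⟩ := h
    exact ⟨r, by simpa using h1, rfl⟩

/-- For fixed columns the overlap is a sum over rows of weights at most `lam k`, so the `k`-subset
moment applies. The right side stays a sum of a constant over admissible row sets, so that it can
afterwards be interchanged with the sum over columns. -/
theorem sum_free_rows_exp_le (hn : 1 ≤ n) (hmk : 2 * (m * k) ≤ n)
    (U : Finset (Fin n × Fin n)) (lam : ℝ) (hlam : 0 ≤ lam) (hlk : lam * k ≤ 1)
    (R : Fin m → {S : Finset (Fin n) // S.card = k}) (x : Fin m) (q : Fin m → Prop)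
    (D : {S : Finset (Fin n) // S.card = k} → Prop) [DecidablePred D]
    (hD : ∀ S, D S ↔ ∀ j, j ≠ x → Disjoint S.1 (R j).1 ∨ q j)
    (T : {T : Finset (Fin n) // T.card = k}) :
    ∑ S ∈ Finset.univ.filter D,
        Real.exp (lam * (Block.entries (S, T) ∩ U).card)
      ≤ ∑ _S ∈ Finset.univ.filter D,
        Real.exp (∑ c ∈ T.1,
          4 * lam * k / n * ((Finset.univ.filter fun r => (r, c) ∈ U).card : ℝ)) := by
  have hwk : ∀ r, ((T.1.filter fun c => (r, c) ∈ U).card : ℝ) ≤ k := by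
    intro r
    have := Finset.card_filter_le T.1 fun c => (r, c) ∈ U
    rw [T.2] at this
    exact_mod_cast this
  have hfw : ∀ S,
      Real.exp (lam * (Block.entries (S, T) ∩ U).card)
        = Real.exp (∑ r ∈ S.1, lam * ((T.1.filter fun c => (r, c) ∈ U).card : ℝ)) := by
    intro _
    rw [← Finset.mul_sum, ← Nat.cast_sum]
    congr 3
    rw [Block.entries, ← Finset.filter_mem_eq_inter, Finset.card_filter, Finset.sum_product]
    exact Finset.sum_congr rfl fun r _ => (Finset.card_filter _ _).symm
  have hwsum : ∑ r, lam * ((T.1.filter fun c => (r, c) ∈ U).card : ℝ)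
      ≤ lam * ∑ c ∈ T.1, ((Finset.univ.filter fun r => (r, c) ∈ U).card : ℝ) := by
    rw [← Finset.mul_sum]
    refine mul_le_mul_of_nonneg_left (le_of_eq ?_) hlam
    rw [← Nat.cast_sum, ← Nat.cast_sum]
    congr 1
    simp_rw [Finset.card_filter]
    exact Finset.sum_comm
  rw [Finset.sum_congr rfl fun _ _ => hfw _, Finset.sum_const, nsmul_eq_mul]
  refine (sum_avoiding_exp_le hmk hn R x q D hD _ (fun r => by positivity) (fun r => ?_) _
    hwsum).trans (le_of_eq ?_)
  · exact (mul_le_mul_of_nonneg_left (hwk r) hlam).trans hlk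
  · congr 2
    rw [← Finset.mul_sum]
    ring

theorem sum_free_columns_exp_le (hn : 1 ≤ n) (hmk : 2 * (m * k) ≤ n)
    (U : Finset (Fin n × Fin n)) (lam : ℝ) (hlam : 0 ≤ lam) (hlk : 4 * (lam * k) ≤ 1)
    (R : Fin m → {S : Finset (Fin n) // S.card = k}) (x : Fin m) (q : Fin m → Prop)
    (D : {S : Finset (Fin n) // S.card = k} → Prop) [DecidablePred D]
    (hD : ∀ S, D S ↔ ∀ j, j ≠ x → Disjoint S.1 (R j).1 ∨ q j) :
    ∑ T ∈ Finset.univ.filter D,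
        Real.exp (∑ c ∈ T.1,
          4 * lam * k / n * ((Finset.univ.filter fun r => (r, c) ∈ U).card : ℝ))
      ≤ (Finset.univ.filter D).card *
          Real.exp (16 * lam * k ^ 2 * U.card / n ^ 2) := by
  have hn0 : (0 : ℝ) < n := by exact_mod_cast hn
  refine (sum_avoiding_exp_le hmk hn R x q D hD _ (fun c => by positivity) (fun c => ?_)
    (4 * lam * k / n * U.card) (by rw [← Finset.mul_sum, sum_card_column])).trans (le_of_eq ?_)
  · have h1 : ((Finset.univ.filter fun r => (r, c) ∈ U).card : ℝ) ≤ n := by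
      have := Finset.card_filter_le (Finset.univ : Finset (Fin n)) fun r => (r, c) ∈ U
      rw [Finset.card_univ, Fintype.card_fin] at this
      exact_mod_cast this
    calc 4 * lam * k / n * ((Finset.univ.filter fun r => (r, c) ∈ U).card : ℝ)
        ≤ 4 * lam * k / n * n := by gcongr
      _ = 4 * (lam * k) := by field_simp
      _ ≤ 1 := hlk
  · congr 2
    field_simp
    ring

/-- Rows are averaged for fixed columns, the sums are interchanged, then columns are averaged for
fixed rows. The admissible pairs need not form a product; only their sections in each direction are
used. Each averaging costs a factor `4 k / n`, whence `16 k² / n²`. -/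
theorem sum_free_blocks_exp_le (hn : 1 ≤ n) (hmk : 2 * (m * k) ≤ n)
    (U : Finset (Fin n × Fin n)) (lam : ℝ) (hlam : 0 ≤ lam) (hlk : 4 * (lam * k) ≤ 1)
    (ω : Fin m → Block n k) (x : Fin m) (Q : Block n k → Prop) [DecidablePred Q]
    (hQ : ∀ v, Q v ↔
      ∀ j, j ≠ x → Disjoint v.1.1 (ω j).1.1 ∨ Disjoint v.2.1 (ω j).2.1) :
    ∑ v ∈ Finset.univ.filter Q,
        Real.exp (lam * (v.entries ∩ U).card)
      ≤ (Finset.univ.filter Q).card *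
          Real.exp (16 * lam * k ^ 2 * U.card / n ^ 2) := by
  have hlk' : lam * k ≤ 1 := by
    have : 0 ≤ lam * k := by positivity
    linarith
  set e : Fin n → ℝ := fun c => ((Finset.univ.filter fun r => (r, c) ∈ U).card : ℝ) with he
  have hrow : ∀ T, ∑ S ∈ Finset.univ.filter (fun S => Q (S, T)),
      Real.exp (lam * (Block.entries (S, T) ∩ U).card) ≤
      ∑ S ∈ Finset.univ.filter (fun S => Q (S, T)), Real.exp (∑ c ∈ T.1, 4 * lam * k / n * e c) :=
    fun T => sum_free_rows_exp_le hn hmk U lam hlam hlk' (fun j => (ω j).1) x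
      (fun j => Disjoint T.1 (ω j).2.1) (fun S => Q (S, T)) (fun S => hQ (S, T)) T
  have hcol : ∀ S, ∑ T ∈ Finset.univ.filter (fun T => Q (S, T)),
      Real.exp (∑ c ∈ T.1, 4 * lam * k / n * e c) ≤
      (Finset.univ.filter fun T => Q (S, T)).card *
        Real.exp (16 * lam * k ^ 2 * U.card / n ^ 2) := by
    intro S
    refine sum_free_columns_exp_le hn hmk U lam hlam hlk (fun j => (ω j).2) x
      (fun j => Disjoint S.1 (ω j).1.1) (fun T => Q (S, T)) fun T => (hQ (S, T)).trans ?_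
    exact forall_congr' fun j => imp_congr_right fun _ => or_comm
  clear_value e
  calc _ = ∑ T, ∑ S ∈ Finset.univ.filter (fun S => Q (S, T)),
        Real.exp (lam * (Block.entries (S, T) ∩ U).card) := by
        simp only [Finset.sum_filter]
        rw [Fintype.sum_prod_type_right]
    _ ≤ _ := Finset.sum_le_sum fun T _ => hrow T
    _ = ∑ S, ∑ T ∈ Finset.univ.filter (fun T => Q (S, T)),
        Real.exp (∑ c ∈ T.1, 4 * lam * k / n * e c) := by
        simp only [Finset.sum_filter]
        rw [Finset.sum_comm]
    _ ≤ _ := Finset.sum_le_sum fun S _ => hcol S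
    _ = _ := by
        rw [← Finset.sum_mul, ← Nat.cast_sum]
        congr 2
        simp only [Finset.card_filter]
        rw [Fintype.sum_prod_type]

/-- Overlap moment for the non-consecutive family when the blocks can be resampled freely. -/
theorem sum_allBlocks_exp_le_of_sparse (hn : 1 ≤ n) (hmk : 2 * (m * k) ≤ n)
    (U : Finset (Fin n × Fin n)) (lam : ℝ) (hlam : 0 ≤ lam) (hlk : 4 * (lam * k) ≤ 1) :
    ∑ ω ∈ tuples (allBlocks n k) m, Real.exp (lam * (planted ω ∩ U).card)
      ≤ (tuples (allBlocks n k) m).card * Real.exp (16 * lam * m * k ^ 2 * U.card / n ^ 2) := by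
  classical
  rw [Finset.sum_congr rfl fun ω hω => exp_planted_inter hω U lam]
  refine (sum_prod_le_of_resampling _ (fun B : Block n k => Real.exp (lam * (B.entries ∩ U).card))
    (fun v => (Real.exp_pos _).le) (Real.exp (16 * lam * k ^ 2 * U.card / n ^ 2))
    (Real.exp_pos _).le fun ω hω x => ?_).trans (le_of_eq ?_)
  · rw [mul_comm]
    refine sum_free_blocks_exp_le hn hmk U lam hlam hlk ω x _ fun v => ?_
    rw [update_mem_tuples hω]
    simp only [allBlocks, Finset.mem_univ, true_and, Block.entries, Finset.disjoint_product]
  · rw [Fintype.card_fin, ← Real.exp_nat_mul]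
    congr 2
    ring

end

/-! ### Circular blocks -/

section

variable {n k m : ℕ}

/-- Separating the unwrapped part from the wrapped part removes the remainder, so that later
statements are linear arithmetic. -/
theorem mem_circInterval (hkn : k ≤ n) (i x : Fin n) :
    x ∈ circInterval k i ↔ (i.1 ≤ x.1 ∧ x.1 < i.1 + k) ∨ (x.1 < i.1 ∧ n + x.1 < i.1 + k) := by
  have hx := x.2
  have hi := i.2
  simp only [circInterval, Finset.mem_image, Finset.mem_range, Fin.ext_iff]
  constructor
  · rintro ⟨j, hj, h⟩
    by_cases hlt : i.1 + j < n
    · rw [Nat.mod_eq_of_lt hlt] at h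
      omega
    · rw [Nat.mod_eq_sub_mod (by omega), Nat.mod_eq_of_lt (by omega)] at h
      omega
  · rintro (h | h)
    · exact ⟨x.1 - i.1, by omega, by rw [Nat.mod_eq_of_lt (by omega)]; omega⟩
    · refine ⟨n + x.1 - i.1, by omega, ?_⟩
      rw [Nat.mod_eq_sub_mod (by omega), Nat.mod_eq_of_lt (by omega)]
      omega

theorem card_circInterval (hkn : k ≤ n) (i : Fin n) : (circInterval k i).card = k := by
  rw [circInterval, Finset.card_image_of_injOn, Finset.card_range]
  intro a ha b hb hab
  have hi := i.2
  simp only [Finset.coe_range, Set.mem_Iio, Fin.mk.injEq] at ha hb hab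
  have hmod : ∀ j, j < k → (i.1 + j) % n = if i.1 + j < n then i.1 + j else i.1 + j - n := by
    intro j hj
    split_ifs with h
    · exact Nat.mod_eq_of_lt h
    · rw [Nat.mod_eq_sub_mod (by omega), Nat.mod_eq_of_lt (by omega)]
  rw [hmod a ha, hmod b hb] at hab
  split_ifs at hab <;> omega

/-- The starting point is the only element whose cyclic predecessor lies outside the interval. This
fails for `k = n`, where all intervals coincide. -/
theorem circInterval_injective (hk : 1 ≤ k) (hkn : k < n) :
    Function.Injective (circInterval k : Fin n → Finset (Fin n)) := by
  intro i j hij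
  have hi := i.2
  have hj := j.2
  have hmem : ∀ x : Fin n, x ∈ circInterval k i ↔ x ∈ circInterval k j := fun x => by rw [hij]
  have h1 := (hmem i).mp ((mem_circInterval hkn.le i i).mpr (by omega))
  rw [mem_circInterval hkn.le] at h1
  by_contra hne
  rw [Fin.ext_iff] at hne
  by_cases h0 : i.1 = 0
  · have h2 := hmem ⟨n - 1, by omega⟩
    rw [mem_circInterval hkn.le, mem_circInterval hkn.le] at h2
    simp only at h2
    omega
  · have h2 := hmem ⟨i.1 - 1, by omega⟩
    rw [mem_circInterval hkn.le, mem_circInterval hkn.le] at h2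
    simp only at h2
    omega

/-- The circular block with the given first row and first column. -/
def circBlock (hkn : k ≤ n) (p : Fin n × Fin n) : Block n k :=
  (⟨circInterval k p.1, card_circInterval hkn p.1⟩, ⟨circInterval k p.2, card_circInterval hkn p.2⟩)

theorem mem_circBlocks (hkn : k ≤ n) {B : Block n k} :
    B ∈ circBlocks n k ↔ ∃ p, circBlock hkn p = B := by
  simp only [circBlocks, Finset.mem_filter, Finset.mem_univ, true_and]
  constructor
  · rintro ⟨⟨i, hi⟩, ⟨j, hj⟩⟩
    exact ⟨(i, j), Prod.ext (Subtype.ext hi.symm) (Subtype.ext hj.symm)⟩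
  · rintro ⟨p, rfl⟩
    exact ⟨⟨p.1, rfl⟩, ⟨p.2, rfl⟩⟩

theorem sq_le_card_circBlocks (hk : 1 ≤ k) (hkn : k < n) : n ^ 2 ≤ (circBlocks n k).card := by
  have hinj : Function.Injective (circBlock hkn.le : Fin n × Fin n → Block n k) := by
    intro p q hpq
    have h1 := congrArg (fun B : Block n k => B.1.1) hpq
    have h2 := congrArg (fun B : Block n k => B.2.1) hpq
    exact Prod.ext (circInterval_injective hk hkn h1) (circInterval_injective hk hkn h2)
  calc n ^ 2 = (Finset.univ.map ⟨_, hinj⟩ : Finset (Block n k)).card := by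
        rw [Finset.card_map, Finset.card_univ, Fintype.card_prod, Fintype.card_fin, sq]
    _ ≤ _ := by
        refine Finset.card_le_card fun B hB => ?_
        obtain ⟨p, -, rfl⟩ := Finset.mem_map.mp hB
        exact (mem_circBlocks hkn.le).mpr ⟨p, rfl⟩

open Classical in
theorem card_circInterval_meeting (hkn : k ≤ n) (i : Fin n) :
    (Finset.univ.filter fun a : Fin n =>
      ¬ Disjoint (circInterval k a) (circInterval k i)).card ≤ 2 * k := by
  -- If two circular intervals of equal length meet, one of them contains the starting point of the
  -- other.
  have hsub : (Finset.univ.filter fun a : Fin n =>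
      ¬ Disjoint (circInterval k a) (circInterval k i)) ⊆
      circInterval k i ∪ Finset.univ.filter fun a : Fin n => i ∈ circInterval k a := by
    intro a ha
    simp only [Finset.mem_filter, Finset.mem_univ, true_and] at ha
    obtain ⟨x, hx1, hx2⟩ := Finset.not_disjoint_iff.mp ha
    rw [Finset.mem_union, Finset.mem_filter]
    simp only [Finset.mem_univ, true_and]
    rw [mem_circInterval hkn] at hx1 hx2 ⊢
    rw [mem_circInterval hkn]
    have := x.2
    have := a.2
    have := i.2
    omega
  have h2 : (Finset.univ.filter fun a : Fin n => i ∈ circInterval k a).card ≤ k := by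
    refine (Finset.card_le_card_of_injOn (t := Finset.range k)
      (fun a => if a.1 ≤ i.1 then i.1 - a.1 else n + i.1 - a.1) ?_ ?_).trans_eq
        (Finset.card_range k)
    · intro a ha
      rw [Finset.mem_coe, Finset.mem_filter] at ha
      replace ha := ha.2
      rw [mem_circInterval hkn] at ha
      simp only [Finset.coe_range, Set.mem_Iio]
      split_ifs <;> omega
    · intro a _ b _ hab
      have := a.2
      have := b.2
      have := i.2
      simp only at hab
      rw [Fin.ext_iff]
      split_ifs at hab <;> omega
  calc _ ≤ _ := Finset.card_le_card hsub
    _ ≤ _ := Finset.card_union_le _ _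
    _ ≤ k + k := Nat.add_le_add (card_circInterval hkn i).le h2
    _ = 2 * k := (two_mul k).symm

open Classical in
theorem card_circBlocks_meeting (hkn : k ≤ n) {B : Block n k} (hB : B ∈ circBlocks n k) :
    ((circBlocks n k).filter fun v => ¬ Disjoint v.entries B.entries).card ≤ 4 * k ^ 2 := by
  obtain ⟨p, rfl⟩ := (mem_circBlocks hkn).mp hB
  have hsub : (circBlocks n k).filter (fun v => ¬ Disjoint v.entries (circBlock hkn p).entries) ⊆
      ((Finset.univ.filter fun a : Fin n => ¬ Disjoint (circInterval k a) (circInterval k p.1)) ×ˢ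
      (Finset.univ.filter fun a : Fin n =>
        ¬ Disjoint (circInterval k a) (circInterval k p.2))).image (circBlock hkn) := by
    intro v hv
    rw [Finset.mem_filter] at hv
    obtain ⟨hv1, hv2⟩ := hv
    obtain ⟨q, rfl⟩ := (mem_circBlocks hkn).mp hv1
    simp only [Block.entries, Finset.disjoint_product, circBlock, not_or] at hv2
    refine Finset.mem_image.mpr ⟨q, ?_, rfl⟩
    simpa using hv2
  calc _ ≤ _ := Finset.card_le_card hsub
    _ ≤ _ := Finset.card_image_le
    _ ≤ (2 * k) * (2 * k) := by
        rw [Finset.card_product]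
        exact Nat.mul_le_mul (card_circInterval_meeting hkn _) (card_circInterval_meeting hkn _)
    _ = 4 * k ^ 2 := by ring

/-- There are circular placements of `m` blocks as soon as `m * k ≤ n`. -/
theorem tuples_circBlocks_nonempty (hk : 1 ≤ k) (hm : 1 ≤ m) (hmk : m * k ≤ n) :
    (tuples (circBlocks n k) m).Nonempty := by
  have hkn : k ≤ n := (Nat.le_mul_of_pos_left k hm).trans hmk
  have hlt : ∀ i : Fin m, i.1 * k + k ≤ n := by
    intro i
    calc i.1 * k + k = (i.1 + 1) * k := by ring
      _ ≤ m * k := Nat.mul_le_mul_right _ i.2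
      _ ≤ n := hmk
  -- The blocks go down the diagonal; `m * k ≤ n` prevents wrapping, and disjoint row sets already
  -- suffice.
  let s : Fin m → Fin n := fun i => ⟨i.1 * k, by have := hlt i; omega⟩
  refine ⟨fun i => circBlock hkn (s i, s i), mem_tuples.mpr
    ⟨fun i => (mem_circBlocks hkn).mpr ⟨_, rfl⟩, ?_⟩⟩
  have hd : ∀ i j : Fin m, i < j → Disjoint (circInterval k (s i)) (circInterval k (s j)) := by
    intro i j hij
    refine Finset.disjoint_left.mpr fun x hx hx' => ?_
    rw [mem_circInterval hkn] at hx hx'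
    have h1 := hlt i
    have h2 := hlt j
    have h3 : i.1 * k + k ≤ j.1 * k := by
      calc i.1 * k + k = (i.1 + 1) * k := by ring
        _ ≤ j.1 * k := Nat.mul_le_mul_right _ hij
    simp only [s] at hx hx'
    omega
  intro i j hij
  simp only [Block.entries, Finset.disjoint_product, circBlock]
  rcases lt_or_gt_of_ne hij with h | h
  · exact Or.inl (hd i j h)
  · exact Or.inl (hd j i h).symm

/-- Overlap moment for the circular family. -/
theorem sum_circBlocks_exp_le (hk : 1 ≤ k) (hmk : m * k ≤ n) (hkn : 8 * k ≤ n)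
    {ω' : Fin m → Block n k} (hω' : ω' ∈ tuples (circBlocks n k) m) (lam : ℝ) (hlam : 0 ≤ lam) :
    ∑ ω ∈ tuples (circBlocks n k) m, Real.exp (lam * (planted ω ∩ planted ω').card)
      ≤ (tuples (circBlocks n k) m).card *
        Real.exp (8 * (m ^ 2 * k ^ 2 / n ^ 2 * (Real.exp (lam * k ^ 2) - 1))) := by
  classical
  have hn0 : (0 : ℝ) < n := by exact_mod_cast (by omega : 0 < n)
  have hkn' : k ≤ n := by omega
  have hE : 0 ≤ Real.exp (lam * k ^ 2) - 1 := by
    rw [sub_nonneg]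
    exact Real.one_le_exp (by positivity)
  -- There are at least `n²` circular blocks, and the placement forbids at most `4 m k² ≤ n² / 2` of
  -- them. Likewise at most `4 m k²` blocks meet `planted ω'`, each with excess at most `exp (lam
  -- k²) - 1`.
  refine (sum_tuples_exp_le (m := m) (𝓑 := circBlocks n k) (planted ω') lam hlam ((n : ℝ) ^ 2 / 2)
    ((m * (4 * k ^ 2)) * (Real.exp (lam * k ^ 2) - 1)) (by positivity) ?_ ?_).trans (le_of_eq ?_)
  · intro ω hω x
    have h1 := card_le_card_update (4 * k ^ 2) (fun B hB => card_circBlocks_meeting hkn' hB) hω x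
    have h2 := sq_le_card_circBlocks hk (show k < n by omega)
    have h3 : 2 * (m * (4 * k ^ 2)) ≤ n ^ 2 := by
      calc 2 * (m * (4 * k ^ 2)) = (m * k) * (8 * k) := by ring
        _ ≤ n * n := Nat.mul_le_mul hmk hkn
        _ = n ^ 2 := (sq n).symm
    have h4 : n ^ 2 ≤ 2 * (Finset.univ.filter fun v =>
        Function.update ω x v ∈ tuples (circBlocks n k) m).card := by omega
    have h5 : (n : ℝ) ^ 2 ≤ 2 * ((Finset.univ.filter fun v =>
        Function.update ω x v ∈ tuples (circBlocks n k) m).card : ℝ) := by exact_mod_cast h4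
    linarith
  · set Z := (circBlocks n k).filter fun v => ¬ Disjoint v.entries (planted ω') with hZ
    have hZc : Z.card ≤ m * (4 * k ^ 2) := by
      have hsub : Z ⊆ Finset.univ.biUnion fun j : Fin m =>
          (circBlocks n k).filter fun v => ¬ Disjoint v.entries (ω' j).entries := by
        intro v hv
        rw [hZ, Finset.mem_filter] at hv
        obtain ⟨p, hp, hp'⟩ := Finset.not_disjoint_iff.mp hv.2
        obtain ⟨j, hj⟩ := mem_planted.mp hp'
        refine Finset.mem_biUnion.mpr ⟨j, Finset.mem_univ _, Finset.mem_filter.mpr ⟨hv.1, ?_⟩⟩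
        exact Finset.not_disjoint_iff.mpr ⟨p, hp, hj⟩
      calc _ ≤ _ := Finset.card_le_card hsub
        _ ≤ _ := Finset.card_biUnion_le
        _ ≤ ∑ _j : Fin m, 4 * k ^ 2 := Finset.sum_le_sum fun j _ =>
            card_circBlocks_meeting hkn' ((mem_tuples.mp hω').1 j)
        _ = m * (4 * k ^ 2) := by simp
    calc ∑ B ∈ circBlocks n k, (Real.exp (lam * (B.entries ∩ planted ω').card) - 1)
        ≤ ∑ B ∈ circBlocks n k,
          if ¬ Disjoint B.entries (planted ω') then Real.exp (lam * k ^ 2) - 1 else 0 := by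
          refine Finset.sum_le_sum fun B _ => ?_
          split_ifs with h
          · rw [Finset.disjoint_iff_inter_eq_empty] at h
            simp [h]
          · have hc : ((B.entries ∩ planted ω').card : ℝ) ≤ k ^ 2 := by
              have := Finset.card_le_card
                (Finset.inter_subset_left (s₁ := B.entries) (s₂ := planted ω'))
              rw [card_entries] at this
              exact_mod_cast this
            gcongr
      _ = Z.card * (Real.exp (lam * k ^ 2) - 1) := by
          rw [← Finset.sum_filter, Finset.sum_const, nsmul_eq_mul]
      _ ≤ _ := by
          refine mul_le_mul_of_nonneg_right ?_ hE
          exact_mod_cast hZc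
  · congr 2
    field_simp
    ring

end

/-! ### Degrees of rows and columns in a uniform placement -/

section

variable {n k m : ℕ}

/-- The image of a `k`-subset under a permutation. -/
def permuteSet (σ : Equiv.Perm (Fin n)) (S : {S : Finset (Fin n) // S.card = k}) :
    {S : Finset (Fin n) // S.card = k} :=
  ⟨S.1.map σ.toEmbedding, by rw [Finset.card_map, S.2]⟩

theorem mem_permuteSet {σ : Equiv.Perm (Fin n)} {S : {S : Finset (Fin n) // S.card = k}}
    {a : Fin n} : a ∈ (permuteSet σ S).1 ↔ σ.symm a ∈ S.1 := by
  simp [permuteSet, Finset.mem_map_equiv]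

theorem permuteSet_permuteSet {σ τ : Equiv.Perm (Fin n)} (h : ∀ a, τ (σ a) = a)
    (S : {S : Finset (Fin n) // S.card = k}) : permuteSet τ (permuteSet σ S) = S := by
  refine Subtype.ext (Finset.ext fun a => ?_)
  rw [mem_permuteSet, mem_permuteSet]
  have h1 : σ.symm (τ.symm a) = a := by
    have := h (σ.symm (τ.symm a))
    simpa using this.symm
  rw [h1]

theorem disjoint_permuteSet (σ : Equiv.Perm (Fin n)) (S T : {S : Finset (Fin n) // S.card = k}) :
    Disjoint (permuteSet σ S).1 (permuteSet σ T).1 ↔ Disjoint S.1 T.1 := by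
  simp [permuteSet]

/-- The number of blocks that use the row `r`. -/
def rowDegree (r : Fin n) (ω : Fin m → Block n k) : ℕ :=
  (Finset.univ.filter fun i => r ∈ (ω i).1.1).card

theorem mem_tuples_allBlocks {ω : Fin m → Block n k} :
    ω ∈ tuples (allBlocks n k) m ↔
      ∀ i j, i ≠ j → Disjoint (ω i).1.1 (ω j).1.1 ∨ Disjoint (ω i).2.1 (ω j).2.1 := by
  simp only [mem_tuples, allBlocks, Finset.mem_univ, implies_true, true_and, Block.entries,
    Finset.disjoint_product]

/-- The moves `r → r'` in a block containing the row `r` that lead to another placement are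
numerous if the degree of `r` exceeds `k`. -/
theorem le_card_moves {ω : Fin m → Block n k} (hω : ω ∈ tuples (allBlocks n k) m) (r : Fin n) :
    rowDegree r ω * n ≤ (Finset.univ.filter fun p : Fin m × Fin n =>
      r ∈ (ω p.1).1.1 ∧ ∀ l, p.2 ∈ (ω l).1.1 → Disjoint (ω p.1).2.1 (ω l).2.1).card
        + m * k ^ 2 := by
  -- A forbidden move `(i, a)` has a planted entry `(a, c)` with `c` a column of block `i`. At most
  -- one block contains `(r, c)`, so each of the `m k²` planted entries forbids at most one move.
  have hsub : (Finset.univ.filter fun i => r ∈ (ω i).1.1) ×ˢ (Finset.univ : Finset (Fin n)) ⊆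
      (Finset.univ.filter fun p : Fin m × Fin n =>
        r ∈ (ω p.1).1.1 ∧ ∀ l, p.2 ∈ (ω l).1.1 → Disjoint (ω p.1).2.1 (ω l).2.1) ∪
      (planted ω).biUnion fun q =>
        (Finset.univ.filter fun i => r ∈ (ω i).1.1 ∧ q.2 ∈ (ω i).2.1) ×ˢ {q.1} := by
    rintro ⟨i, a⟩ hp
    simp only [Finset.mem_product, Finset.mem_filter, Finset.mem_univ, true_and, and_true] at hp
    rw [Finset.mem_union, Finset.mem_filter]
    by_cases h : ∀ l, a ∈ (ω l).1.1 → Disjoint (ω i).2.1 (ω l).2.1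
    · exact Or.inl ⟨Finset.mem_univ _, hp, h⟩
    · push Not at h
      obtain ⟨l, hl, hd⟩ := h
      obtain ⟨c, hc, hc'⟩ := Finset.not_disjoint_iff.mp hd
      refine Or.inr (Finset.mem_biUnion.mpr ⟨(a, c), ?_, ?_⟩)
      · exact mem_planted.mpr ⟨l, Finset.mem_product.mpr ⟨hl, hc'⟩⟩
      · simp [hp, hc]
  have h1 := Finset.card_le_card hsub
  rw [Finset.card_product, Finset.card_univ, Fintype.card_fin] at h1
  refine h1.trans ((Finset.card_union_le _ _).trans (Nat.add_le_add_left ?_ _))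
  rw [← card_planted hω, ← Nat.mul_one (planted ω).card]
  refine Finset.card_biUnion_le_card_mul _ _ _ fun q _ => ?_
  rw [Finset.card_product, Finset.card_singleton, mul_one, Finset.card_le_one]
  intro i hi j hj
  simp only [Finset.mem_filter, Finset.mem_univ, true_and] at hi hj
  exact eq_of_mem_entries hω (p := (r, q.2)) (Finset.mem_product.mpr hi)
    (Finset.mem_product.mpr hj)

/-- A block sharing a column with block `i` has rows disjoint from it and, by the choice of `a`,
avoids row `a`; trading `r` for `a` therefore creates no collision. -/
theorem move_mem_tuples {ω : Fin m → Block n k}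
    (hω : ω ∈ tuples (allBlocks n k) m) {r a : Fin n} {i : Fin m} (hr : r ∈ (ω i).1.1)
    (ha : ∀ l, a ∈ (ω l).1.1 → Disjoint (ω i).2.1 (ω l).2.1) :
    Function.update ω i (permuteSet (Equiv.swap r a) (ω i).1, (ω i).2) ∈
      tuples (allBlocks n k) m := by
  rw [update_mem_tuples hω]
  refine ⟨Finset.mem_univ _, fun l hl => ?_⟩
  simp only [Block.entries, Finset.disjoint_product]
  rcases mem_tuples_allBlocks.mp hω i l (Ne.symm hl) with h | h
  · by_cases hT : Disjoint (ω i).2.1 (ω l).2.1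
    · exact Or.inr hT
    · refine Or.inl (Finset.disjoint_left.mpr fun x hx hx' => ?_)
      rw [mem_permuteSet, Equiv.symm_swap] at hx
      have hxa : x ≠ a := fun e => hT (ha l (e ▸ hx'))
      have hxr : x ≠ r := fun e => Finset.disjoint_left.mp h hr (e ▸ hx')
      rw [Equiv.swap_apply_of_ne_of_ne hxr hxa] at hx
      exact Finset.disjoint_left.mp h hx hx'
  · exact Or.inr h

/-- Switching: high degrees are increasingly rare. -/
theorem card_rowDegree_succ_le (hn : 1 ≤ n) (hmk : m * k ≤ n) (r : Fin n) (j : ℕ) :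
    (j + 1 - k) * ((tuples (allBlocks n k) m).filter fun ω => j + 1 ≤ rowDegree r ω).card
      ≤ ((tuples (allBlocks n k) m).filter fun ω => j ≤ rowDegree r ω).card := by
  set D := (tuples (allBlocks n k) m).filter fun ω => j + 1 ≤ rowDegree r ω with hD
  set D' := (tuples (allBlocks n k) m).filter fun ω => j ≤ rowDegree r ω with hD'
  let moves : (Fin m → Block n k) → Finset (Fin m × Fin n) := fun ω =>
    Finset.univ.filter fun p => r ∈ (ω p.1).1.1 ∧
      ∀ l, p.2 ∈ (ω l).1.1 → Disjoint (ω p.1).2.1 (ω l).2.1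
  let back : (Fin m → Block n k) → Finset (Fin m × Fin n) := fun ω =>
    Finset.univ.filter fun p => p.2 ∈ (ω p.1).1.1
  have hlow : D.card * ((j + 1 - k) * n) ≤ (D.sigma moves).card := by
    rw [Finset.card_sigma, ← smul_eq_mul]
    refine Finset.card_nsmul_le_sum _ _ _ fun ω hω => ?_
    rw [hD, Finset.mem_filter] at hω
    have h1 := le_card_moves hω.1 r
    have h2 : m * k ^ 2 ≤ k * n := by
      calc m * k ^ 2 = k * (m * k) := by ring
        _ ≤ k * n := Nat.mul_le_mul_left _ hmk
    have h3 : (j + 1) * n ≤ rowDegree r ω * n := Nat.mul_le_mul_right _ hω.2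
    rw [Nat.sub_mul]
    change _ ≤ (moves ω).card
    change _ ≤ (moves ω).card + _ at h1
    omega
  -- A reverse move is determined by a block and one of its rows, giving `m k ≤ n` possibilities.
  have hup : (D'.sigma back).card ≤ D'.card * n := by
    rw [Finset.card_sigma, ← smul_eq_mul, ← Finset.sum_const]
    refine Finset.sum_le_sum fun ω _ => le_trans (le_of_eq ?_) hmk
    have : back ω = Finset.univ.biUnion fun i => {i} ×ˢ (ω i).1.1 := by
      ext ⟨i, a⟩
      simp [back]
    rw [this, Finset.card_biUnion]
    · simp [(fun i => (ω i).1.2 : ∀ i, (ω i).1.1.card = k)]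
    · intro i _ l _ hil
      rw [Function.onFun, Finset.disjoint_left]
      rintro ⟨a, b⟩ h1 h2
      simp only [Finset.mem_product, Finset.mem_singleton] at h1 h2
      exact hil (h1.1.symm.trans h2.1)
  -- The label `(i, a)` is kept with the switched tuple; repeating the transposition recovers the
  -- original, and the degree of `r` falls by at most one.
  have hmap : (D.sigma moves).card ≤ (D'.sigma back).card := by
    refine Finset.card_le_card_of_injOn (fun p => ⟨Function.update p.1 p.2.1
      (permuteSet (Equiv.swap r p.2.2) (p.1 p.2.1).1, (p.1 p.2.1).2), p.2⟩) ?_ ?_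
    · rintro ⟨ω, i, a⟩ hp
      simp only [Finset.coe_sigma, Set.mem_sigma_iff, Finset.mem_coe, hD, hD', moves, back,
        Finset.mem_filter, Finset.mem_univ, true_and] at hp ⊢
      obtain ⟨⟨hω, hdeg⟩, hr, ha⟩ := hp
      refine ⟨⟨move_mem_tuples hω hr ha, ?_⟩, ?_⟩
      · have hsub : (Finset.univ.filter fun l => r ∈ (ω l).1.1).erase i ⊆
            Finset.univ.filter fun l => r ∈ (Function.update ω i
              (permuteSet (Equiv.swap r a) (ω i).1, (ω i).2) l).1.1 := by
          intro l hl
          rw [Finset.mem_erase, Finset.mem_filter] at hl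
          rw [Finset.mem_filter, Function.update_of_ne hl.1]
          exact hl.2
        have h1 := Finset.card_le_card hsub
        have h2 := Finset.pred_card_le_card_erase (s := Finset.univ.filter fun l => r ∈ (ω l).1.1)
          (a := i)
        unfold rowDegree at hdeg ⊢
        omega
      · rw [Function.update_self, mem_permuteSet, Equiv.symm_swap, Equiv.swap_apply_right]
        exact hr
    · have hrec : ∀ (ω : Fin m → Block n k) (i : Fin m) (a : Fin n),
          Function.update (Function.update ω i (permuteSet (Equiv.swap r a) (ω i).1, (ω i).2)) i
            (permuteSet (Equiv.swap r a) (permuteSet (Equiv.swap r a) (ω i).1), (ω i).2) = ω := by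
        intro ω i a
        rw [permuteSet_permuteSet (Equiv.swap_apply_self r a), Function.update_idem,
          Function.update_eq_self]
      rintro ⟨ω, i, a⟩ _ ⟨ω', i', a'⟩ _ heq
      simp only [Sigma.mk.injEq, heq_eq_eq, Prod.mk.injEq] at heq
      obtain ⟨h1, rfl, rfl⟩ := heq
      have h2 := congrFun h1 i
      rw [Function.update_self, Function.update_self, Prod.mk.injEq] at h2
      have h3 : ω = ω' := by rw [← hrec ω i a, ← hrec ω' i a, h1, h2.1, h2.2]
      rw [h3]
  refine Nat.le_of_mul_le_mul_right ?_ (show 0 < n by omega)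
  calc (j + 1 - k) * D.card * n = D.card * ((j + 1 - k) * n) := by ring
    _ ≤ D'.card * n := hlow.trans (hmap.trans hup)

/-- Above degree `2 k` every switching step gains a factor at least `k`. Four steps give `k⁻⁴`,
enough for a union bound over the `2 n` rows and columns when `n < 2 k³`. -/
theorem card_rowDegree_le (hn : 1 ≤ n) (hmk : m * k ≤ n) (r : Fin n) :
    k ^ 4 * ((tuples (allBlocks n k) m).filter fun ω => 2 * k + 4 ≤ rowDegree r ω).card
      ≤ (tuples (allBlocks n k) m).card := by
  have h : ∀ s, k ^ s * ((tuples (allBlocks n k) m).filter fun ω =>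
      2 * k + s ≤ rowDegree r ω).card ≤ (tuples (allBlocks n k) m).card := by
    intro s
    induction s with
    | zero => simpa using Finset.card_filter_le _ _
    | succ s ih =>
      refine le_trans ?_ ih
      rw [pow_succ, mul_assoc]
      refine Nat.mul_le_mul_left _ (le_trans (Nat.mul_le_mul_right _ ?_)
        (card_rowDegree_succ_le hn hmk r (2 * k + s)))
      omega
  exact h 4

/-- Exchanging the roles of rows and columns. -/
def flipTuple (ω : Fin m → Block n k) : Fin m → Block n k := fun i => ((ω i).2, (ω i).1)

theorem flipTuple_mem {ω : Fin m → Block n k} (hω : ω ∈ tuples (allBlocks n k) m) :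
    flipTuple ω ∈ tuples (allBlocks n k) m := by
  rw [mem_tuples_allBlocks] at hω ⊢
  exact fun i j hij => (hω i j hij).symm

open Classical in
/-- Placements without rows or columns of high degree. -/
def balanced (n k m : ℕ) : Finset (Fin m → Block n k) :=
  (tuples (allBlocks n k) m).filter fun ω =>
    ∀ r, rowDegree r ω < 2 * k + 4 ∧ rowDegree r (flipTuple ω) < 2 * k + 4

theorem card_le_card_balanced (hn : 1 ≤ n) (hmk : m * k ≤ n) :
    k ^ 4 * (tuples (allBlocks n k) m).card
      ≤ k ^ 4 * (balanced n k m).card + 2 * n * (tuples (allBlocks n k) m).card := by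
  classical
  set Om := tuples (allBlocks n k) m with hOm
  have hsub : Om ⊆ balanced n k m ∪ Finset.univ.biUnion fun r =>
      (Om.filter fun ω => 2 * k + 4 ≤ rowDegree r ω) ∪
      (Om.filter fun ω => 2 * k + 4 ≤ rowDegree r (flipTuple ω)) := by
    intro ω hω
    by_cases h : ∀ r, rowDegree r ω < 2 * k + 4 ∧ rowDegree r (flipTuple ω) < 2 * k + 4
    · exact Finset.mem_union_left _ (Finset.mem_filter.mpr ⟨hω, h⟩)
    · push Not at h
      obtain ⟨r, hr⟩ := h
      refine Finset.mem_union_right _ (Finset.mem_biUnion.mpr ⟨r, Finset.mem_univ r, ?_⟩)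
      rw [Finset.mem_union, Finset.mem_filter, Finset.mem_filter]
      by_cases h1 : rowDegree r ω < 2 * k + 4
      · exact Or.inr ⟨hω, hr h1⟩
      · exact Or.inl ⟨hω, not_lt.mp h1⟩
  have hflip : ∀ r, (Om.filter fun ω => 2 * k + 4 ≤ rowDegree r (flipTuple ω)).card
      ≤ (Om.filter fun ω => 2 * k + 4 ≤ rowDegree r ω).card := by
    intro r
    refine Finset.card_le_card_of_injOn flipTuple ?_ ?_
    · intro ω hω
      rw [Finset.mem_coe, Finset.mem_filter] at hω ⊢
      exact ⟨flipTuple_mem hω.1, hω.2⟩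
    · intro ω _ ω' _ h
      have : flipTuple (flipTuple ω) = flipTuple (flipTuple ω') := by rw [h]
      exact this
  have h1 := (Finset.card_le_card hsub).trans (Finset.card_union_le _ _)
  have h2 := Finset.card_biUnion_le (s := (Finset.univ : Finset (Fin n))) (t := fun r =>
      (Om.filter fun ω => 2 * k + 4 ≤ rowDegree r ω) ∪
      (Om.filter fun ω => 2 * k + 4 ≤ rowDegree r (flipTuple ω)))
  have h3 : k ^ 4 * ∑ r : Fin n, ((Om.filter fun ω => 2 * k + 4 ≤ rowDegree r ω) ∪
      (Om.filter fun ω => 2 * k + 4 ≤ rowDegree r (flipTuple ω))).card ≤ 2 * n * Om.card := by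
    rw [Finset.mul_sum]
    calc _ ≤ ∑ _r : Fin n, 2 * Om.card := by
          refine Finset.sum_le_sum fun r _ => ?_
          have h4 := Finset.card_union_le (Om.filter fun ω => 2 * k + 4 ≤ rowDegree r ω)
            (Om.filter fun ω => 2 * k + 4 ≤ rowDegree r (flipTuple ω))
          have h5 := hflip r
          have h6 := card_rowDegree_le hn hmk r
          calc _ ≤ k ^ 4 * (2 * (Om.filter fun ω => 2 * k + 4 ≤ rowDegree r ω).card) :=
                Nat.mul_le_mul_left _ (by omega)
            _ = 2 * (k ^ 4 * (Om.filter fun ω => 2 * k + 4 ≤ rowDegree r ω).card) := by ring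
            _ ≤ _ := Nat.mul_le_mul_left _ h6
      _ = 2 * n * Om.card := by
          rw [Finset.sum_const, Finset.card_univ, Fintype.card_fin, smul_eq_mul]
          ring
  calc k ^ 4 * Om.card ≤ k ^ 4 * ((balanced n k m).card + _) :=
        Nat.mul_le_mul_left _ (h1.trans (Nat.add_le_add_left h2 _))
    _ ≤ _ := by
        rw [mul_add]
        exact Nat.add_le_add_left h3 _

/-! ### Overlap of randomly permuted placements -/

/-- `sum_perm_exp_le` is applied to `σ` with `τ` fixed, then to `τ`, and each use contributes `8 /
n`. The bounds `R` on row sums and column sums of `u` keep the summands small in the first and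
second use respectively; the second needs `2 * 8 * lam * R ≤ 1`. -/
theorem sum_perm_perm_exp_le (hn : 1 ≤ n) (u u' : Fin n → Fin n → ℝ) (hu : ∀ a b, 0 ≤ u a b)
    (hu' : ∀ a b, 0 ≤ u' a b) (hu1 : ∀ a b, u' a b ≤ 1) (R : ℝ) (hR : ∀ a, ∑ b, u a b ≤ R)
    (hR' : ∀ b, ∑ a, u a b ≤ R) (lam : ℝ) (hlam : 0 ≤ lam) (hlR : 16 * (lam * R) ≤ 1) :
    ∑ τ : Equiv.Perm (Fin n), ∑ σ : Equiv.Perm (Fin n),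
        Real.exp (lam * ∑ a, ∑ b, u a b * u' (σ a) (τ b))
      ≤ (n.factorial : ℝ) ^ 2 *
        Real.exp (64 * lam / n ^ 2 * ((∑ a, ∑ b, u a b) * ∑ a, ∑ b, u' a b)) := by
  have hn0 : (0 : ℝ) < n := by exact_mod_cast hn
  have hR0 : 0 ≤ R := le_trans (Finset.sum_nonneg fun b _ => hu ⟨0, hn⟩ b) (hR ⟨0, hn⟩)
  have hlR0 : 0 ≤ lam * R := mul_nonneg hlam hR0
  set e : Fin n → ℝ := fun b => ∑ a, u a b with he
  set e' : Fin n → ℝ := fun b => ∑ a, u' a b with he'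
  have he0 : ∀ b, 0 ≤ e b := fun b => Finset.sum_nonneg fun a _ => hu a b
  have he0' : ∀ b, 0 ≤ e' b := fun b => Finset.sum_nonneg fun a _ => hu' a b
  have hen' : ∀ b, e' b ≤ n := fun b => by
    calc e' b ≤ ∑ _a : Fin n, (1 : ℝ) := Finset.sum_le_sum fun a _ => hu1 a b
      _ = n := by simp
  have hrow : ∀ τ : Equiv.Perm (Fin n), ∑ σ : Equiv.Perm (Fin n),
      Real.exp (lam * ∑ a, ∑ b, u a b * u' (σ a) (τ b))
      ≤ n.factorial * Real.exp (∑ b, 8 * lam / n * (e b * e' (τ b))) := by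
    intro τ
    have h := sum_perm_exp_le hn (fun a c => lam * ∑ b, u a b * u' c (τ b))
      (fun a c => mul_nonneg hlam (Finset.sum_nonneg fun b _ => mul_nonneg (hu _ _) (hu' _ _)))
      (fun a c => by
        have h1 : ∑ b, u a b * u' c (τ b) ≤ R := le_trans
          (Finset.sum_le_sum fun b _ => mul_le_of_le_one_right (hu a b) (hu1 _ _)) (hR a)
        have := mul_le_mul_of_nonneg_left h1 hlam
        linarith)
    simp_rw [← Finset.mul_sum] at h
    refine h.trans (le_of_eq ?_)
    congr 2
    have h2 : ∑ a, ∑ c, ∑ b, u a b * u' c (τ b) = ∑ b, e b * e' (τ b) := by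
      simp_rw [he, he', Finset.sum_mul_sum]
      calc _ = ∑ a, ∑ b, ∑ c, u a b * u' c (τ b) :=
            Finset.sum_congr rfl fun a _ => Finset.sum_comm
        _ = _ := Finset.sum_comm
    rw [h2, ← Finset.mul_sum]
    ring
  have hcol := sum_perm_exp_le hn (fun b c => 8 * lam / n * (e b * e' c))
    (fun b c => by have := he0 b; have := he0' c; positivity)
    (fun b c => by
      have h1 : e b * e' c ≤ R * n := mul_le_mul (hR' b) (hen' c) (he0' c) hR0
      have h2 : 8 * lam / n * (e b * e' c) ≤ 8 * lam / n * (R * n) := by gcongr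
      have h3 : 8 * lam / n * (R * n) = 8 * (lam * R) := by field_simp
      linarith)
  calc _ ≤ ∑ τ : Equiv.Perm (Fin n),
          n.factorial * Real.exp (∑ b, 8 * lam / n * (e b * e' (τ b))) :=
        Finset.sum_le_sum fun τ _ => hrow τ
    _ ≤ n.factorial * (n.factorial *
          Real.exp (8 / n * ∑ b, ∑ c, 8 * lam / n * (e b * e' c))) := by
        rw [← Finset.mul_sum]
        exact mul_le_mul_of_nonneg_left hcol (by positivity)
    _ = _ := by
        rw [← mul_assoc, ← sq]
        congr 2
        simp_rw [← Finset.mul_sum, ← Finset.sum_mul]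
        rw [show ∑ b, e b = ∑ a, ∑ b, u a b from Finset.sum_comm,
          show ∑ b, e' b = ∑ a, ∑ b, u' a b from Finset.sum_comm]
        field_simp
        ring

/-- Simultaneous permutation of the rows and of the columns. -/
def permuteTuple (σ τ : Equiv.Perm (Fin n)) (ω : Fin m → Block n k) : Fin m → Block n k :=
  fun i => (permuteSet σ (ω i).1, permuteSet τ (ω i).2)

theorem rowDegree_permuteTuple (σ τ : Equiv.Perm (Fin n)) (ω : Fin m → Block n k) (r : Fin n) :
    rowDegree r (permuteTuple σ τ ω) = rowDegree (σ.symm r) ω := by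
  simp only [rowDegree, permuteTuple, mem_permuteSet]

theorem permuteTuple_mem_balanced (σ τ : Equiv.Perm (Fin n)) {ω : Fin m → Block n k}
    (hω : ω ∈ balanced n k m) : permuteTuple σ τ ω ∈ balanced n k m := by
  rw [balanced, Finset.mem_filter, mem_tuples_allBlocks] at hω ⊢
  refine ⟨fun i j hij => ?_, fun r => ⟨?_, ?_⟩⟩
  · simp only [permuteTuple, disjoint_permuteSet]
    exact hω.1 i j hij
  · rw [rowDegree_permuteTuple]
    exact (hω.2 _).1
  · change rowDegree r (permuteTuple τ σ (flipTuple ω)) < _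
    rw [rowDegree_permuteTuple]
    exact (hω.2 _).2

theorem permuteTuple_permuteTuple (σ τ : Equiv.Perm (Fin n)) {σ' τ' : Equiv.Perm (Fin n)}
    (hσ : ∀ a, σ' (σ a) = a) (hτ : ∀ a, τ' (τ a) = a) (ω : Fin m → Block n k) :
    permuteTuple σ' τ' (permuteTuple σ τ ω) = ω := by
  funext i
  simp only [permuteTuple, permuteSet_permuteSet hσ, permuteSet_permuteSet hτ]

theorem sum_balanced_permuteTuple (σ τ : Equiv.Perm (Fin n)) (H : (Fin m → Block n k) → ℝ) :
    ∑ ω ∈ balanced n k m, H (permuteTuple σ τ ω) = ∑ ω ∈ balanced n k m, H ω :=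
  Finset.sum_bij' (fun ω _ => permuteTuple σ τ ω) (fun ω _ => permuteTuple σ.symm τ.symm ω)
    (fun _ h => permuteTuple_mem_balanced σ τ h)
    (fun _ h => permuteTuple_mem_balanced σ.symm τ.symm h)
    (fun ω _ => permuteTuple_permuteTuple σ τ (by simp) (by simp) ω)
    (fun ω _ => permuteTuple_permuteTuple σ.symm τ.symm (by simp) (by simp) ω)
    (fun _ _ => rfl)

theorem card_planted_permuteTuple_inter (σ τ : Equiv.Perm (Fin n)) (ω : Fin m → Block n k)
    (U : Finset (Fin n × Fin n)) :
    ((planted (permuteTuple σ τ ω) ∩ U).card : ℝ) =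
      ∑ a, ∑ b, (if (a, b) ∈ planted ω then 1 else 0) * (if (σ a, τ b) ∈ U then 1 else 0) := by
  have h1 : planted (permuteTuple σ τ ω) =
      (planted ω).map (Equiv.prodCongr σ τ).toEmbedding := by
    ext ⟨a, b⟩
    simp [mem_planted, permuteTuple, Block.entries, mem_permuteSet, Finset.mem_map_equiv]
  rw [h1, ← Finset.filter_mem_eq_inter, Finset.card_filter, Finset.sum_map, Nat.cast_sum,
    ← Fintype.sum_prod_type']
  simp_rw [ite_mul, one_mul, zero_mul]
  rw [Finset.sum_ite_mem, Finset.univ_inter]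
  exact Finset.sum_congr rfl fun p _ => Nat.cast_ite _ _ _ |>.trans (by simp [Prod.map])

theorem sum_planted_row_le {ω : Fin m → Block n k} (r : Fin n) :
    ∑ b, (if (r, b) ∈ planted ω then (1 : ℝ) else 0) ≤ k * rowDegree r ω := by
  have h : (Finset.univ.filter fun b => (r, b) ∈ planted ω) ⊆
      (Finset.univ.filter fun i => r ∈ (ω i).1.1).biUnion fun i => (ω i).2.1 := by
    intro b hb
    rw [Finset.mem_filter, mem_planted] at hb
    obtain ⟨-, i, hi⟩ := hb
    rw [Block.entries, Finset.mem_product] at hi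
    exact Finset.mem_biUnion.mpr ⟨i, by simpa using hi.1, hi.2⟩
  have h2 := (Finset.card_le_card h).trans
    (Finset.card_biUnion_le_card_mul _ _ k fun i _ => (ω i).2.2.le)
  rw [Finset.sum_boole, mul_comm]
  exact_mod_cast h2

theorem mem_planted_flipTuple {ω : Fin m → Block n k} {a b : Fin n} :
    (a, b) ∈ planted (flipTuple ω) ↔ (b, a) ∈ planted ω := by
  simp [mem_planted, flipTuple, Block.entries, and_comm]

theorem sum_sum_planted {ω : Fin m → Block n k} (hω : ω ∈ tuples (allBlocks n k) m) :
    ∑ a, ∑ b, (if (a, b) ∈ planted ω then (1 : ℝ) else 0) = m * k ^ 2 := by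
  rw [← Fintype.sum_prod_type' (f := fun a b => if (a, b) ∈ planted ω then (1 : ℝ) else 0)]
  simp [card_planted hω]

/-- Overlap second moment of the balanced placements. -/
theorem sum_balanced_exp_le (hk : 1 ≤ k) (hn : 1 ≤ n) (lam : ℝ) (hlam : 0 ≤ lam)
    (hlk : 96 * (lam * k ^ 2) ≤ 1) :
    ∑ ω ∈ balanced n k m, ∑ ω' ∈ balanced n k m, Real.exp (lam * (planted ω ∩ planted ω').card)
      ≤ (balanced n k m).card ^ 2 * Real.exp (64 * lam * m ^ 2 * k ^ 4 / n ^ 2) := by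
  have hfac : (0 : ℝ) < (n.factorial : ℝ) ^ 2 := by
    have := n.factorial_pos
    positivity
  have hk1 : (1 : ℝ) ≤ k := by exact_mod_cast hk
  have hmem : ∀ ω ∈ balanced n k m, ω ∈ tuples (allBlocks n k) m := fun ω h =>
    (Finset.mem_filter.mp h).1
  have hdeg : ∀ ω ∈ balanced n k m, ∀ r, rowDegree r ω < 2 * k + 4 ∧
      rowDegree r (flipTuple ω) < 2 * k + 4 := fun ω h => (Finset.mem_filter.mp h).2
  -- A line of degree `d` has at most `k d` planted entries, and `2 k + 3 ≤ 6 k`. The resulting `R =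
  -- 6 k²` turns `16 lam R ≤ 1` into the hypothesis with 96.
  have hsix : ∀ d : ℕ, d < 2 * k + 4 → (k : ℝ) * d ≤ 6 * k ^ 2 := by
    intro d hd
    have : (d : ℝ) ≤ 6 * k := by exact_mod_cast (by omega : d ≤ 6 * k)
    nlinarith
  have hpair : ∀ ω ∈ balanced n k m, ∀ ω' ∈ balanced n k m,
      ∑ τ : Equiv.Perm (Fin n), ∑ σ : Equiv.Perm (Fin n),
        Real.exp (lam * (planted (permuteTuple σ τ ω) ∩ planted ω').card)
      ≤ (n.factorial : ℝ) ^ 2 * Real.exp (64 * lam * m ^ 2 * k ^ 4 / n ^ 2) := by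
    intro ω hω ω' hω'
    simp_rw [card_planted_permuteTuple_inter]
    refine (sum_perm_perm_exp_le hn (fun a b => if (a, b) ∈ planted ω then 1 else 0)
      (fun a b => if (a, b) ∈ planted ω' then 1 else 0) (fun a b => by positivity)
      (fun a b => by positivity) (fun a b => by split_ifs <;> norm_num) (6 * k ^ 2)
      (fun a => (sum_planted_row_le a).trans (hsix _ (hdeg ω hω a).1)) (fun b => ?_) lam hlam
      (by linarith)).trans (le_of_eq ?_)
    · simp_rw [← mem_planted_flipTuple (ω := ω)]
      exact (sum_planted_row_le b).trans (hsix _ (hdeg ω hω b).2)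
    · rw [sum_sum_planted (hmem ω hω), sum_sum_planted (hmem ω' hω')]
      congr 2
      ring
  -- Balanced placements are invariant under row and column permutations, so averaging over both
  -- permutations leaves the double sum unchanged.
  have hsym : (n.factorial : ℝ) ^ 2 * ∑ ω ∈ balanced n k m, ∑ ω' ∈ balanced n k m,
        Real.exp (lam * (planted ω ∩ planted ω').card)
      = ∑ ω ∈ balanced n k m, ∑ ω' ∈ balanced n k m,
        ∑ τ : Equiv.Perm (Fin n), ∑ σ : Equiv.Perm (Fin n),
          Real.exp (lam * (planted (permuteTuple σ τ ω) ∩ planted ω').card) := by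
    have h1 : ∀ τ σ : Equiv.Perm (Fin n), ∑ ω ∈ balanced n k m, ∑ ω' ∈ balanced n k m,
        Real.exp (lam * (planted (permuteTuple σ τ ω) ∩ planted ω').card)
        = ∑ ω ∈ balanced n k m, ∑ ω' ∈ balanced n k m,
          Real.exp (lam * (planted ω ∩ planted ω').card) := fun τ σ =>
      sum_balanced_permuteTuple σ τ fun ω => ∑ ω' ∈ balanced n k m,
        Real.exp (lam * (planted ω ∩ planted ω').card)
    calc _ = ∑ τ : Equiv.Perm (Fin n), ∑ σ : Equiv.Perm (Fin n),
          ∑ ω ∈ balanced n k m, ∑ ω' ∈ balanced n k m,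
            Real.exp (lam * (planted (permuteTuple σ τ ω) ∩ planted ω').card) := by
          simp_rw [h1]
          simp [Fintype.card_perm]
          ring
      _ = _ := by
          simp_rw [Finset.sum_comm (s := (Finset.univ : Finset (Equiv.Perm (Fin n))))
            (t := balanced n k m)]
  refine le_of_mul_le_mul_left ?_ hfac
  rw [hsym]
  calc _ ≤ ∑ ω ∈ balanced n k m, ∑ ω' ∈ balanced n k m,
        (n.factorial : ℝ) ^ 2 * Real.exp (64 * lam * m ^ 2 * k ^ 4 / n ^ 2) :=
        Finset.sum_le_sum fun ω hω => Finset.sum_le_sum fun ω' hω' => hpair ω hω ω' hω'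
    _ = _ := by
        simp only [Finset.sum_const, nsmul_eq_mul]
        ring

end

/-! ### Gaussian likelihood ratios -/

/-- The density of `N(a, v)` with respect to the standard normal law. -/
noncomputable def gaussianRatio (a : ℝ) (v : ℝ≥0) (x : ℝ) : ℝ :=
  gaussianPDFReal a v x / gaussianPDFReal 0 1 x

theorem measurable_gaussianRatio (a : ℝ) (v : ℝ≥0) : Measurable (gaussianRatio a v) :=
  (measurable_gaussianPDFReal a v).div (measurable_gaussianPDFReal 0 1)

theorem gaussianRatio_nonneg (a : ℝ) (v : ℝ≥0) (x : ℝ) : 0 ≤ gaussianRatio a v x :=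
  div_nonneg (gaussianPDFReal_nonneg _ _ _) (gaussianPDFReal_nonneg _ _ _)

theorem gaussianReal_eq_withDensity (a : ℝ) {v : ℝ≥0} (hv : v ≠ 0) :
    gaussianReal a v = stdNormal.withDensity fun x => ENNReal.ofReal (gaussianRatio a v x) := by
  rw [stdNormal, gaussianReal_of_var_ne_zero a hv, gaussianReal_of_var_ne_zero 0 one_ne_zero,
    ← withDensity_mul _ (measurable_gaussianPDF 0 1)
      (measurable_gaussianRatio a v).ennreal_ofReal]
  congr 1
  funext x
  have h := gaussianPDFReal_pos 0 1 x one_ne_zero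
  simp only [Pi.mul_apply, gaussianPDF, gaussianRatio]
  rw [← ENNReal.ofReal_mul h.le, mul_div_cancel₀ _ h.ne']

theorem integral_gaussianRatio (a : ℝ) {v : ℝ≥0} (hv : v ≠ 0) :
    ∫ x, gaussianRatio a v x ∂stdNormal = 1 := by
  rw [integral_eq_lintegral_of_nonneg_ae
    (Eventually.of_forall fun x => gaussianRatio_nonneg a v x)
    (measurable_gaussianRatio a v).aestronglyMeasurable]
  have h : (gaussianReal a v) Set.univ = 1 := measure_univ
  rw [gaussianReal_eq_withDensity a hv, withDensity_apply _ MeasurableSet.univ,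
    Measure.restrict_univ] at h
  rw [h, ENNReal.toReal_one]

theorem gaussianRatio_one (a x : ℝ) : gaussianRatio a 1 x = Real.exp (a * x - a ^ 2 / 2) := by
  have h : √(2 * Real.pi * ((1 : ℝ≥0) : ℝ)) ≠ 0 := by
    rw [Real.sqrt_ne_zero']
    simp [Real.pi_pos]
  rw [gaussianRatio, gaussianPDFReal, gaussianPDFReal, mul_div_mul_left _ _ (inv_ne_zero h),
    ← Real.exp_sub]
  congr 1
  simp only [NNReal.coe_one]
  ring

theorem integral_gaussianRatio_one_mul (a b : ℝ) :
    Integrable (fun x => gaussianRatio a 1 x * gaussianRatio b 1 x) stdNormal ∧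
      ∫ x, gaussianRatio a 1 x * gaussianRatio b 1 x ∂stdNormal = Real.exp (a * b) := by
  have h : (fun x => gaussianRatio a 1 x * gaussianRatio b 1 x)
      = fun x => Real.exp (-(a ^ 2 + b ^ 2) / 2) * Real.exp ((a + b) * x) := by
    funext x
    rw [gaussianRatio_one, gaussianRatio_one, ← Real.exp_add, ← Real.exp_add]
    congr 1
    ring
  rw [h]
  refine ⟨(integrable_exp_mul_gaussianReal (a + b)).const_mul _, ?_⟩
  have hm := congrFun (mgf_id_gaussianReal (μ := 0) (v := 1)) (a + b)
  simp only [mgf, id] at hm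
  rw [integral_const_mul, stdNormal, hm, ← Real.exp_add]
  congr 1
  simp only [NNReal.coe_one]
  ring

theorem meanShift_correlationBound {k m : ℕ} (ϑ : Fin m → Fin k × Fin k → ℝ) (lam : ℝ)
    (h : ∀ l u l' u', ϑ l u * ϑ l' u' ≤ lam) :
    CorrelationBound (meanShift ϑ) (fun l u => gaussianRatio (ϑ l u) 1) lam where
  measurable l u := measurable_gaussianRatio _ _
  nonneg l u x := gaussianRatio_nonneg _ _ _
  law l u := gaussianReal_eq_withDensity _ one_ne_zero
  integral_eq_one l u := integral_gaussianRatio _ one_ne_zero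
  integrable_mul l u l' u' := (integral_gaussianRatio_one_mul _ _).1
  integral_mul_le l u l' u' := by
    rw [(integral_gaussianRatio_one_mul _ _).2]
    exact Real.exp_le_exp.mpr (h l u l' u')

/-- The precisions combine as `1 / (1 + a) + 1 / (1 + b) - 1 = (1 - a b) / ((1 + a) (1 + b))`, so
the product is again a centred Gaussian density up to the factor `(1 - a b)^(-1/2)`, which is the
correlation. -/
theorem gaussianPDFReal_mul_ratio (a b : ℝ) (ha : 0 ≤ a) (hb : 0 ≤ b) (hab : a * b < 1) (x : ℝ) :
    gaussianPDFReal 0 1 x *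
        (gaussianRatio 0 (1 + a).toNNReal x * gaussianRatio 0 (1 + b).toNNReal x)
      = (√(1 - a * b))⁻¹ *
        gaussianPDFReal 0 ((1 + a) * (1 + b) / (1 - a * b)).toNNReal x := by
  have h1 : 0 < 1 - a * b := by linarith
  have h := gaussianPDFReal_pos 0 1 x one_ne_zero
  have e : gaussianPDFReal 0 1 x *
        (gaussianRatio 0 (1 + a).toNNReal x * gaussianRatio 0 (1 + b).toNNReal x)
      = gaussianPDFReal 0 (1 + a).toNNReal x * gaussianPDFReal 0 (1 + b).toNNReal x /
        gaussianPDFReal 0 1 x := by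
    simp only [gaussianRatio]
    field_simp
  rw [e, div_eq_iff h.ne']
  simp only [gaussianPDFReal, sub_zero, NNReal.coe_one, mul_one]
  rw [Real.coe_toNNReal _ (by linarith), Real.coe_toNNReal _ (by linarith),
    Real.coe_toNNReal _ (by positivity)]
  have hsq : (√(2 * Real.pi * (1 + a)))⁻¹ * (√(2 * Real.pi * (1 + b)))⁻¹
      = (√(1 - a * b))⁻¹ * (√(2 * Real.pi * ((1 + a) * (1 + b) / (1 - a * b))))⁻¹
        * (√(2 * Real.pi))⁻¹ := by
    rw [← Real.sqrt_inv, ← Real.sqrt_inv, ← Real.sqrt_inv, ← Real.sqrt_inv, ← Real.sqrt_inv,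
      ← Real.sqrt_mul (by positivity), ← Real.sqrt_mul (by positivity),
      ← Real.sqrt_mul (by positivity)]
    congr 1
    have := Real.pi_pos
    field_simp
  have hexp : Real.exp (-x ^ 2 / (2 * (1 + a))) * Real.exp (-x ^ 2 / (2 * (1 + b)))
      = Real.exp (-x ^ 2 / (2 * ((1 + a) * (1 + b) / (1 - a * b)))) * Real.exp (-x ^ 2 / 2) := by
    rw [← Real.exp_add, ← Real.exp_add]
    congr 1
    field_simp
    ring
  calc _ = ((√(2 * Real.pi * (1 + a)))⁻¹ * (√(2 * Real.pi * (1 + b)))⁻¹) *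
        (Real.exp (-x ^ 2 / (2 * (1 + a))) * Real.exp (-x ^ 2 / (2 * (1 + b)))) := by ring
    _ = _ := by
        rw [hsq, hexp]
        ring

theorem integral_gaussianRatio_var_mul (a b : ℝ) (ha : 0 ≤ a) (hb : 0 ≤ b) (hab : a * b < 1) :
    Integrable (fun x => gaussianRatio 0 (1 + a).toNNReal x * gaussianRatio 0 (1 + b).toNNReal x)
        stdNormal ∧
      ∫ x, gaussianRatio 0 (1 + a).toNNReal x * gaussianRatio 0 (1 + b).toNNReal x ∂stdNormal
        = (√(1 - a * b))⁻¹ := by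
  have h1 : 0 < 1 - a * b := by linarith
  have hw : ((1 + a) * (1 + b) / (1 - a * b)).toNNReal ≠ 0 := by
    rw [ne_eq, Real.toNNReal_eq_zero, not_le]
    positivity
  constructor
  · rw [stdNormal, gaussianReal_of_var_ne_zero 0 one_ne_zero,
      integrable_withDensity_iff_integrable_smul' (measurable_gaussianPDF 0 1)
        (Eventually.of_forall fun x => gaussianPDF_lt_top)]
    simp only [toReal_gaussianPDF, smul_eq_mul, gaussianPDFReal_mul_ratio a b ha hb hab]
    exact (integrable_gaussianPDFReal _ _).const_mul _
  · rw [stdNormal, integral_gaussianReal_eq_integral_smul one_ne_zero]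
    simp only [smul_eq_mul, gaussianPDFReal_mul_ratio a b ha hb hab]
    rw [integral_const_mul, integral_gaussianPDFReal_eq_one 0 hw, mul_one]

/-- With `s` the product of two shifts, `(1 - s)^(-1/2) ≤ (1 - s)⁻¹ = 1 + s / (1 - s) ≤ exp (s / (1
- s))`. -/
theorem varShift_correlationBound {k m : ℕ} (ϑ : Fin m → Fin k × Fin k → ℝ) (lam : ℝ)
    (h0 : ∀ l u, 0 ≤ ϑ l u) (h1 : ∀ l u l' u', ϑ l u * ϑ l' u' < 1)
    (h : ∀ l u l' u', ϑ l u * ϑ l' u' / (1 - ϑ l u * ϑ l' u') ≤ lam) :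
    CorrelationBound (varShift ϑ) (fun l u => gaussianRatio 0 (1 + ϑ l u).toNNReal) lam := by
  have hv : ∀ l u, (1 + ϑ l u).toNNReal ≠ 0 := fun l u => by
    rw [ne_eq, Real.toNNReal_eq_zero, not_le]
    linarith [h0 l u]
  refine ⟨fun l u => measurable_gaussianRatio _ _, fun l u x => gaussianRatio_nonneg _ _ _,
    fun l u => gaussianReal_eq_withDensity _ (hv l u),
    fun l u => integral_gaussianRatio _ (hv l u),
    fun l u l' u' => (integral_gaussianRatio_var_mul _ _ (h0 l u) (h0 l' u') (h1 l u l' u')).1,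
    fun l u l' u' => ?_⟩
  rw [(integral_gaussianRatio_var_mul _ _ (h0 l u) (h0 l' u') (h1 l u l' u')).2]
  set s := ϑ l u * ϑ l' u' with hs
  have hs0 : 0 ≤ s := mul_nonneg (h0 _ _) (h0 _ _)
  have hs1 : 0 < 1 - s := by linarith [h1 l u l' u']
  have hroot : 1 - s ≤ √(1 - s) := Real.le_sqrt_of_sq_le (by nlinarith)
  calc (√(1 - s))⁻¹ ≤ (1 - s)⁻¹ := inv_anti₀ hs1 hroot
    _ = s / (1 - s) + 1 := by field_simp; ring
    _ ≤ Real.exp (s / (1 - s)) := Real.add_one_le_exp _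
    _ ≤ Real.exp lam := Real.exp_le_exp.mpr (h l u l' u')

/-! ### Non-asymptotic bounds -/

section

variable {n k m : ℕ} {P : Fin m → Fin k × Fin k → Measure ℝ}
  {r : Fin m → Fin k × Fin k → ℝ → ℝ} {lam : ℝ}

theorem CorrelationBound.tvDist_le_of_forall (h : CorrelationBound P r lam) (hk : 1 ≤ k)
    {𝓑 : Finset (Block n k)} (hne : (tuples 𝓑 m).Nonempty) (t : ℝ) (ht : 0 < t)
    (hsec : ∀ ω' ∈ tuples 𝓑 m, ∑ ω ∈ tuples 𝓑 m, Real.exp (lam * (planted ω ∩ planted ω').card)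
      ≤ (tuples 𝓑 m).card * (1 + t ^ 2)) :
    tvDist (nullLaw n) (altLaw 𝓑 P) ≤ t / 2 := by
  have hc : (0 : ℝ) < (tuples 𝓑 m).card := by exact_mod_cast hne.card_pos
  have := h.tvDist_le hk 𝓑 (tuples 𝓑 m) subset_rfl hne t ht (by
    rw [Finset.sum_comm]
    refine (Finset.sum_le_sum hsec).trans (le_of_eq ?_)
    rw [Finset.sum_const, nsmul_eq_mul]
    ring)
  rw [div_self hc.ne'] at this
  linarith

theorem CorrelationBound.tvDist_circBlocks_le (h : CorrelationBound P r lam) (hm : 1 ≤ m)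
    (hk : 1 ≤ k) (hmk : m * k ≤ n) (hlam : 0 ≤ lam) (ε : ℝ) (hε : 0 ≤ ε) (hε1 : ε ≤ 1)
    (hl : lam * k ^ 2 ≤ ε * Real.log (1 + (n : ℝ) ^ 2 / ((k : ℝ) ^ 2 * (m : ℝ) ^ 2)))
    (t : ℝ) (ht : 0 < t) (hεt : Real.exp (512 * ε) ≤ 1 + t ^ 2) :
    tvDist (nullLaw n) (altLaw (circBlocks n k) P) ≤ t / 2 := by
  have hm0 : (0 : ℝ) < m := by exact_mod_cast hm
  have hk0 : (0 : ℝ) < k := by exact_mod_cast hk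
  have hmk0 : 0 < m * k := Nat.mul_pos hm hk
  have hn0 : (0 : ℝ) < n := by exact_mod_cast hmk0.trans_le hmk
  set y : ℝ := (n : ℝ) ^ 2 / ((k : ℝ) ^ 2 * (m : ℝ) ^ 2) with hy
  have hy0 : 0 < y := by positivity
  refine h.tvDist_le_of_forall hk (tuples_circBlocks_nonempty hk hm hmk) t ht fun ω' hω' => ?_
  by_cases hkn : 8 * k ≤ n
  · refine (sum_circBlocks_exp_le hk hmk hkn hω' lam hlam).trans ?_
    refine mul_le_mul_of_nonneg_left (le_trans (Real.exp_le_exp.mpr ?_) hεt) (by positivity)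
    -- Bernoulli for an exponent in `[0, 1]` turns the logarithmic threshold into an excess linear
    -- in `ε y`, which the factor `m² k² / n² = 1 / y` cancels.
    have h1 : Real.exp (lam * k ^ 2) ≤ 1 + ε * y := by
      calc Real.exp (lam * k ^ 2) ≤ Real.exp (ε * Real.log (1 + y)) := Real.exp_le_exp.mpr hl
        _ = (1 + y) ^ ε := by
            rw [Real.rpow_def_of_pos (by linarith), mul_comm]
        _ ≤ 1 + ε * y := rpow_one_add_le_one_add_mul_self (by linarith) hε hε1
    calc 8 * ((m : ℝ) ^ 2 * k ^ 2 / n ^ 2 * (Real.exp (lam * k ^ 2) - 1))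
        ≤ 8 * ((m : ℝ) ^ 2 * k ^ 2 / n ^ 2 * (ε * y)) := by
          gcongr
          linarith
      _ = 8 * ε := by
          rw [hy]
          field_simp
      _ ≤ 512 * ε := by linarith
  -- For huge blocks `m < 8` and `y ≤ 64`, so the trivial overlap bound `m k²` suffices, with
  -- exponent at most `8 * 64 * ε`. This is the origin of 512.
  · push Not at hkn
    have hm8 : m < 8 := by
      by_contra hcon
      push Not at hcon
      have := Nat.mul_le_mul_right k hcon
      omega
    have hm8' : (m : ℝ) ≤ 8 := by exact_mod_cast hm8.le
    have hy64 : y ≤ 64 := by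
      have h1 : (n : ℝ) ≤ 8 * k := by exact_mod_cast hkn.le
      have h2 : (1 : ℝ) ≤ m := by exact_mod_cast hm
      rw [hy, div_le_iff₀ (by positivity)]
      calc (n : ℝ) ^ 2 ≤ (8 * k) ^ 2 := by gcongr
        _ = 64 * ((k : ℝ) ^ 2 * 1 ^ 2) := by ring
        _ ≤ 64 * ((k : ℝ) ^ 2 * (m : ℝ) ^ 2) := by gcongr
    have hlog : Real.log (1 + y) ≤ 64 := by
      have := Real.log_le_sub_one_of_pos (show 0 < 1 + y by linarith)
      linarith
    have hexp : ∀ ω ∈ tuples (circBlocks n k) m,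
        Real.exp (lam * (planted ω ∩ planted ω').card) ≤ 1 + t ^ 2 := by
      intro ω hω
      refine le_trans (Real.exp_le_exp.mpr ?_) hεt
      have hc : ((planted ω ∩ planted ω').card : ℝ) ≤ m * k ^ 2 := by
        have := Finset.card_le_card (Finset.inter_subset_left (s₁ := planted ω)
          (s₂ := planted ω'))
        rw [card_planted hω] at this
        exact_mod_cast this
      calc lam * (planted ω ∩ planted ω').card ≤ lam * (m * k ^ 2) := by gcongr
        _ = m * (lam * k ^ 2) := by ring
        _ ≤ 8 * (ε * 64) := by
            refine mul_le_mul hm8' (hl.trans ?_) (by positivity) (by norm_num)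
            gcongr
        _ = 512 * ε := by ring
    refine (Finset.sum_le_sum hexp).trans (le_of_eq ?_)
    rw [Finset.sum_const, nsmul_eq_mul]

/-- The side `k` of the minimum gives `lam k ≤ ε`, as needed when `2 m k ≤ n`. The other side bounds
the mean-overlap term `lam m² k⁴ / n²` by `ε` and, when `2 m k > n`, gives `lam k² ≤ 4 ε`. Only the
balanced regime `n < 2 k³` uses `η`. -/
theorem CorrelationBound.tvDist_allBlocks_le (h : CorrelationBound P r lam) (hm : 1 ≤ m)
    (hk : 1 ≤ k) (hmk : m * k ≤ n) (hlam : 0 ≤ lam) (ε : ℝ) (hε1 : ε ≤ 1 / 400)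
    (hl : lam * k ^ 2 ≤ ε * min (k : ℝ) ((n : ℝ) ^ 2 / ((m : ℝ) ^ 2 * (k : ℝ) ^ 2)))
    (t : ℝ) (ht : 0 < t) (hεt : Real.exp (512 * ε) ≤ 1 + t ^ 2) (η : ℝ) (hη0 : 0 ≤ η)
    (hη1 : η < 1) (hη : n < 2 * k ^ 3 → 4 / (k : ℝ) ≤ η) :
    tvDist (nullLaw n) (altLaw (allBlocks n k) P) ≤ t / 2 + η := by
  have hm0 : (0 : ℝ) < m := by exact_mod_cast hm
  have hk0 : (0 : ℝ) < k := by exact_mod_cast hk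
  have hn : 1 ≤ n := (Nat.mul_pos hm hk).trans_le hmk
  have hn0 : (0 : ℝ) < n := by exact_mod_cast hn
  set y : ℝ := (n : ℝ) ^ 2 / ((m : ℝ) ^ 2 * (k : ℝ) ^ 2) with hy
  have hy0 : 0 < y := by positivity
  have hε : 0 ≤ ε := by
    have h1 : 0 < min (k : ℝ) y := lt_min hk0 hy0
    have h2 : 0 ≤ lam * k ^ 2 := by positivity
    exact le_of_mul_le_mul_right (by linarith) h1
  have hlk : lam * k ≤ ε := by
    have h1 : lam * k ^ 2 ≤ ε * k := hl.trans (by gcongr; exact min_le_left _ _)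
    refine le_of_mul_le_mul_right ?_ hk0
    calc lam * k * k = lam * k ^ 2 := by ring
      _ ≤ ε * k := h1
  have hly : lam * k ^ 2 ≤ ε * y := hl.trans (by gcongr; exact min_le_right _ _)
  have hmain : lam * m ^ 2 * k ^ 4 / n ^ 2 ≤ ε := by
    calc lam * m ^ 2 * k ^ 4 / n ^ 2 = (lam * k ^ 2) / y := by rw [hy]; field_simp
      _ ≤ ε := by rwa [div_le_iff₀ hy0]
  have hmain0 : 0 ≤ lam * m ^ 2 * k ^ 4 / n ^ 2 := by positivity
  have hne : (tuples (allBlocks n k) m).Nonempty := by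
    obtain ⟨ω, hω⟩ := tuples_circBlocks_nonempty (n := n) hk hm hmk
    exact ⟨ω, mem_tuples.mpr ⟨fun i => Finset.mem_univ _, (mem_tuples.mp hω).2⟩⟩
  by_cases hA : 2 * (m * k) ≤ n
  · refine (h.tvDist_le_of_forall hk hne t ht fun ω' hω' => ?_).trans (by linarith)
    refine (sum_allBlocks_exp_le_of_sparse hn hA (planted ω') lam hlam (by linarith)).trans ?_
    refine mul_le_mul_of_nonneg_left (le_trans (Real.exp_le_exp.mpr ?_) hεt) (by positivity)
    rw [card_planted hω']
    calc 16 * lam * m * k ^ 2 * ((m * k ^ 2 : ℕ) : ℝ) / n ^ 2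
        = 16 * (lam * m ^ 2 * k ^ 4 / n ^ 2) := by push_cast; ring
      _ ≤ 512 * ε := by linarith
  push Not at hA
  have hy4 : y ≤ 4 := by
    have h1 : (n : ℝ) ≤ 2 * (m * k) := by exact_mod_cast hA.le
    rw [hy, div_le_iff₀ (by positivity)]
    calc (n : ℝ) ^ 2 ≤ (2 * (m * k)) ^ 2 := by gcongr
      _ = 4 * ((m : ℝ) ^ 2 * (k : ℝ) ^ 2) := by ring
  have hlk2 : lam * k ^ 2 ≤ 4 * ε := by
    have : ε * y ≤ ε * 4 := by gcongr
    linarith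
  by_cases hC : 2 * k ^ 3 ≤ n
  · refine (h.tvDist_le_of_forall hk hne t ht fun ω' hω' => ?_).trans (by linarith)
    refine (sum_allBlocks_exp_le_of_small hk hmk hC (planted ω') lam hlam (by linarith)).trans ?_
    refine mul_le_mul_of_nonneg_left (le_trans (Real.exp_le_exp.mpr ?_) hεt) (by positivity)
    rw [card_planted hω']
    calc 4 * lam * m * k ^ 2 * ((m * k ^ 2 : ℕ) : ℝ) / n ^ 2
        = 4 * (lam * m ^ 2 * k ^ 4 / n ^ 2) := by push_cast; ring
      _ ≤ 512 * ε := by linarith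
  push Not at hC
  have hk4 := hη hC
  have hOc : (0 : ℝ) < (tuples (allBlocks n k) m).card := by exact_mod_cast hne.card_pos
  have hbal : 1 - ((balanced n k m).card : ℝ) / (tuples (allBlocks n k) m).card ≤ 4 / k := by
    have h1 : (k : ℝ) ^ 4 * (tuples (allBlocks n k) m).card
        ≤ k ^ 4 * (balanced n k m).card + 2 * n * (tuples (allBlocks n k) m).card := by
      exact_mod_cast card_le_card_balanced (m := m) hn hmk
    have h2 : (n : ℝ) ≤ 2 * k ^ 3 := by exact_mod_cast hC.le
    have h3 : 2 * (n : ℝ) * (tuples (allBlocks n k) m).card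
        ≤ 2 * (2 * k ^ 3) * (tuples (allBlocks n k) m).card := by gcongr
    rw [sub_le_iff_le_add, ← sub_le_iff_le_add', le_div_iff₀ hOc]
    refine le_of_mul_le_mul_left ?_ (show (0 : ℝ) < k ^ 4 by positivity)
    have h4 : (k : ℝ) ^ 4 * ((1 - 4 / k) * (tuples (allBlocks n k) m).card)
        = k ^ 4 * (tuples (allBlocks n k) m).card
          - 2 * (2 * k ^ 3) * (tuples (allBlocks n k) m).card := by
      field_simp
      ring
    linarith
  -- An empty balanced family would force `1 ≤ 4 / k ≤ η < 1`.
  have hbne : (balanced n k m).Nonempty := by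
    rw [← Finset.card_pos]
    by_contra hcon
    have : (balanced n k m).card = 0 := by omega
    rw [this] at hbal
    norm_num at hbal
    linarith
  have hsub : balanced n k m ⊆ tuples (allBlocks n k) m := fun ω hω =>
    (Finset.mem_filter.mp hω).1
  refine (h.tvDist_le hk (allBlocks n k) (balanced n k m) hsub hbne t ht ?_).trans (by linarith)
  refine (sum_balanced_exp_le hk hn lam hlam (by linarith)).trans ?_
  rw [mul_comm]
  refine mul_le_mul_of_nonneg_right (le_trans (Real.exp_le_exp.mpr ?_) hεt) (by positivity)
  calc 64 * lam * m ^ 2 * k ^ 4 / n ^ 2 = 64 * (lam * m ^ 2 * k ^ 4 / n ^ 2) := by ring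
    _ ≤ 512 * ε := by linarith

end

/-! ### Asymptotics -/

theorem tvDist_nonneg {Ω : Type*} [MeasurableSpace Ω] (μ ν : Measure Ω) : 0 ≤ tvDist μ ν :=
  mul_nonneg (by norm_num) (integral_nonneg fun _ => abs_nonneg _)

theorem energy_nonneg {k m : ℕ} (ϑ : Fin m → Fin k × Fin k → ℝ) : 0 ≤ energy ϑ :=
  Real.iSup_nonneg fun _ => Finset.sum_nonneg fun _ _ => sq_nonneg _

/-- Non-spikiness bounds each square by `C E / k²`, and `2 a b ≤ a² + b²` extends this to products
of values from different templates. -/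
theorem mul_le_energy_div {k m : ℕ} (hk : 1 ≤ k) (ϑ : Fin m → Fin k × Fin k → ℝ) (C : ℝ)
    (hC : 0 ≤ C) (h : ∀ l, (k : ℝ) ^ 2 * ‖ϑ l‖ ^ 2 ≤ C * templateEnergy (ϑ l))
    (l : Fin m) (u : Fin k × Fin k) (l' : Fin m) (u' : Fin k × Fin k) :
    ϑ l u * ϑ l' u' ≤ C * energy ϑ / k ^ 2 := by
  have hk0 : (0 : ℝ) < (k : ℝ) ^ 2 := by positivity
  have hsq : ∀ l u, ϑ l u ^ 2 ≤ C * energy ϑ / k ^ 2 := by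
    intro l u
    have h1 : ϑ l u ^ 2 ≤ ‖ϑ l‖ ^ 2 := by
      rw [← sq_abs, ← Real.norm_eq_abs]
      exact pow_le_pow_left₀ (norm_nonneg _) (norm_le_pi_norm (ϑ l) u) 2
    have h2 : templateEnergy (ϑ l) ≤ energy ϑ :=
      le_ciSup (f := fun l => templateEnergy (ϑ l)) (Set.finite_range _).bddAbove l
    rw [le_div_iff₀ hk0]
    calc ϑ l u ^ 2 * k ^ 2 ≤ k ^ 2 * ‖ϑ l‖ ^ 2 := by
          rw [mul_comm]
          gcongr
      _ ≤ C * templateEnergy (ϑ l) := h l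
      _ ≤ C * energy ϑ := by gcongr
  have h1 := hsq l u
  have h2 := hsq l' u'
  nlinarith [sq_nonneg (ϑ l u - ϑ l' u')]

section

variable {m k : ℕ → ℕ} {ϑ : ∀ n, Fin (m n) → Fin (k n) × Fin (k n) → ℝ}
  {P : ∀ n, Fin (m n) → Fin (k n) × Fin (k n) → Measure ℝ}

/-- The bound `1 / 400` secures `96 * (4 ε) ≤ 1` for the balanced placements; 512 dominates the
exponents of all regimes. -/
theorem exists_eps (t : ℝ) (ht : 0 < t) :
    ∃ ε : ℝ, 0 < ε ∧ ε ≤ 1 / 400 ∧ Real.exp (512 * ε) ≤ 1 + t ^ 2 := by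
  have h : 0 < Real.log (1 + t ^ 2) := Real.log_pos (by nlinarith)
  refine ⟨min (1 / 400) (Real.log (1 + t ^ 2) / 512), by positivity, min_le_left _ _, ?_⟩
  rw [← Real.le_log_iff_exp_le (by positivity)]
  have := min_le_right (1 / 400) (Real.log (1 + t ^ 2) / 512)
  linarith

theorem eventually_energy_le {g : ℕ → ℝ} (hg : ∀ n, 0 ≤ g n)
    (ho : (fun n => energy (ϑ n)) =o[atTop] g) (D : ℝ) (hD : 0 ≤ D) (ε : ℝ) (hε : 0 < ε) :
    ∀ᶠ n in atTop, D * energy (ϑ n) ≤ ε * g n := by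
  filter_upwards [ho.bound (show 0 < ε / (D + 1) by positivity)] with n hn
  rw [Real.norm_of_nonneg (energy_nonneg _), Real.norm_of_nonneg (hg n)] at hn
  calc D * energy (ϑ n) ≤ (D + 1) * energy (ϑ n) := by
        have := energy_nonneg (ϑ n)
        gcongr
        linarith
    _ ≤ (D + 1) * (ε / (D + 1) * g n) := by gcongr
    _ = ε * g n := by field_simp

theorem detectionImpossible_of_le {𝓑 : ∀ n, Finset (Block n (k n))}
    (h : ∀ δ : ℝ, 0 < δ → ∀ᶠ n in atTop, tvDist (nullLaw n) (altLaw (𝓑 n) (P n)) < δ) :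
    DetectionImpossible m k 𝓑 P := by
  refine tendsto_order.mpr ⟨fun a ha => ?_, fun a ha => h a ha⟩
  exact Eventually.of_forall fun n => ha.trans_le (tvDist_nonneg _ _)

theorem detectionImpossible_allBlocks
    (hdim : ∀ᶠ n in atTop, 1 ≤ m n ∧ 1 ≤ k n ∧ m n * k n ≤ n) (D : ℝ) (hD : 0 ≤ D)
    (hP : ∀ᶠ n in atTop, ∃ r, CorrelationBound (P n) r (D * energy (ϑ n) / (k n : ℝ) ^ 2))
    (ho : (fun n => energy (ϑ n)) =o[atTop]
      (fun n : ℕ => min (k n : ℝ) ((n : ℝ) ^ 2 / ((m n : ℝ) ^ 2 * (k n : ℝ) ^ 2)))) :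
    DetectionImpossible m k (fun n => allBlocks n (k n)) P := by
  refine detectionImpossible_of_le fun δ hδ => ?_
  obtain ⟨ε, hε0, hε1, hεt⟩ := exists_eps δ hδ
  set η : ℝ := min (δ / 4) (1 / 2) with hη
  have hη0 : 0 < η := by positivity
  have hη1 : η < 1 := (min_le_right _ _).trans_lt (by norm_num)
  have hηδ : η ≤ δ / 4 := min_le_left _ _
  filter_upwards [hdim, hP, eventually_energy_le (fun n => by positivity) ho D hD ε hε0,
    eventually_ge_atTop (2 * ⌈4 / η⌉₊ ^ 3)] with n ⟨hm, hk, hmk⟩ ⟨r, hr⟩ hen hn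
  have hk0 : (0 : ℝ) < k n := by exact_mod_cast hk
  have hen0 := energy_nonneg (ϑ n)
  refine (hr.tvDist_allBlocks_le hm hk hmk (by positivity) ε hε1 ?_ δ hδ hεt η hη0.le hη1
    fun hlt => ?_).trans_lt (by linarith)
  · rwa [div_mul_cancel₀ _ (by positivity)]
  -- In the regime `n < 2 k³` the side length is forced to infinity with `n`, which makes the
  -- discarded fraction `4 / k` at most `η`.
  · have h1 : ⌈4 / η⌉₊ < k n := by
      refine lt_of_pow_lt_pow_left₀ 3 (Nat.zero_le _) ?_
      omega
    have h2 : 4 / η ≤ k n := (Nat.le_ceil _).trans (by exact_mod_cast h1.le)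
    rw [div_le_iff₀ hη0] at h2
    rw [div_le_iff₀ hk0]
    linarith

theorem detectionImpossible_circBlocks
    (hdim : ∀ᶠ n in atTop, 1 ≤ m n ∧ 1 ≤ k n ∧ m n * k n ≤ n) (D : ℝ) (hD : 0 ≤ D)
    (hP : ∀ᶠ n in atTop, ∃ r, CorrelationBound (P n) r (D * energy (ϑ n) / (k n : ℝ) ^ 2))
    (ho : (fun n => energy (ϑ n)) =o[atTop]
      (fun n : ℕ => Real.log (1 + (n : ℝ) ^ 2 / ((k n : ℝ) ^ 2 * (m n : ℝ) ^ 2)))) :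
    DetectionImpossible m k (fun n => circBlocks n (k n)) P := by
  refine detectionImpossible_of_le fun δ hδ => ?_
  obtain ⟨ε, hε0, hε1, hεt⟩ := exists_eps δ hδ
  filter_upwards [hdim, hP, eventually_energy_le (fun n => Real.log_nonneg (by
    have : (0 : ℝ) ≤ (n : ℝ) ^ 2 / ((k n : ℝ) ^ 2 * (m n : ℝ) ^ 2) := by positivity
    linarith)) ho D hD ε hε0] with n ⟨hm, hk, hmk⟩ ⟨r, hr⟩ hen
  have hk0 : (0 : ℝ) < k n := by exact_mod_cast hk
  have hen0 := energy_nonneg (ϑ n)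
  refine (hr.tvDist_circBlocks_le hm hk hmk (by positivity) ε hε0.le (by linarith) ?_ δ hδ
    hεt).trans_lt (by linarith)
  rwa [div_mul_cancel₀ _ (by positivity)]

theorem SmoothSignal.exists_mul_le (hdim : ∀ᶠ n in atTop, 1 ≤ m n ∧ 1 ≤ k n ∧ m n * k n ≤ n)
    (h : SmoothSignal m k ϑ) :
    ∃ D : ℝ, 0 ≤ D ∧ ∀ᶠ n in atTop, ∀ l u l' u',
      ϑ n l u * ϑ n l' u' ≤ D * energy (ϑ n) / (k n : ℝ) ^ 2 := by
  obtain ⟨-, C, hC⟩ := h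
  refine ⟨|C|, abs_nonneg C, ?_⟩
  filter_upwards [hdim, hC] with n ⟨_, hk, _⟩ hn
  refine mul_le_energy_div hk (ϑ n) |C| (abs_nonneg C) fun l => (hn l).trans ?_
  exact mul_le_mul_of_nonneg_right (le_abs_self C) (Finset.sum_nonneg fun _ _ => sq_nonneg _)

theorem SmoothSignal.exists_meanShift
    (hdim : ∀ᶠ n in atTop, 1 ≤ m n ∧ 1 ≤ k n ∧ m n * k n ≤ n) (h : SmoothSignal m k ϑ) :
    ∃ D : ℝ, 0 ≤ D ∧ ∀ᶠ n in atTop, ∃ r,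
      CorrelationBound (meanShift (ϑ n)) r (D * energy (ϑ n) / (k n : ℝ) ^ 2) := by
  obtain ⟨D, hD, hn⟩ := h.exists_mul_le hdim
  exact ⟨D, hD, hn.mono fun n hn => ⟨_, meanShift_correlationBound (ϑ n) _ hn⟩⟩

theorem SmoothSignal.exists_varShift
    (hdim : ∀ᶠ n in atTop, 1 ≤ m n ∧ 1 ≤ k n ∧ m n * k n ≤ n) (h : SmoothSignal m k ϑ)
    (hv : VarAdmissible m k ϑ) :
    ∃ D : ℝ, 0 ≤ D ∧ ∀ᶠ n in atTop, ∃ r,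
      CorrelationBound (varShift (ϑ n)) r (D * energy (ϑ n) / (k n : ℝ) ^ 2) := by
  obtain ⟨D, hD, hn⟩ := h.exists_mul_le hdim
  obtain ⟨ϑ₀, hϑ₀, hv⟩ := hv
  set c : ℝ := max ϑ₀ 0 with hc
  have hc0 : 0 ≤ c := le_max_right _ _
  have hc1 : c < 1 := max_lt hϑ₀ one_pos
  have hcc : c * c < 1 := by nlinarith
  -- Shifts bounded by `c < 1` keep `1 - s` above `1 - c²`, so the denominator in the correlation
  -- bound costs only a constant.
  refine ⟨D / (1 - c * c), div_nonneg hD (by linarith), ?_⟩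
  filter_upwards [hn, hv] with n hn hv
  have hprod : ∀ l u l' u', ϑ n l u * ϑ n l' u' ≤ c * c := fun l u l' u' =>
    mul_le_mul ((hv l u).2.trans (le_max_left _ _)) ((hv l' u').2.trans (le_max_left _ _))
      (hv l' u').1 hc0
  refine ⟨_, varShift_correlationBound (ϑ n) _ (fun l u => (hv l u).1)
    (fun l u l' u' => (hprod l u l' u').trans_lt hcc) fun l u l' u' => ?_⟩
  have h1 := hprod l u l' u'
  have h2 : 0 ≤ ϑ n l u * ϑ n l' u' := mul_nonneg (hv l u).1 (hv l' u').1
  calc ϑ n l u * ϑ n l' u' / (1 - ϑ n l u * ϑ n l' u')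
      ≤ (D * energy (ϑ n) / (k n : ℝ) ^ 2) / (1 - c * c) :=
        div_le_div₀ (h2.trans (hn l u l' u')) (hn l u l' u') (by linarith) (by linarith)
    _ = D / (1 - c * c) * energy (ϑ n) / (k n : ℝ) ^ 2 := by ring

end

end Submatrix

theorem mainTheorem4 (m k : ℕ → ℕ)
    (hdim : ∀ᶠ n in atTop, 1 ≤ m n ∧ 1 ≤ k n ∧ m n * k n ≤ n)
    (ϑ : ∀ n, Fin (m n) → Fin (k n) × Fin (k n) → ℝ)
    (hsmooth : Submatrix.SmoothSignal m k ϑ) :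
    -- non-consecutive placements
    ((fun n => Submatrix.energy (ϑ n)) =o[atTop]
        (fun n : ℕ => min (k n : ℝ) ((n : ℝ) ^ 2 / ((m n : ℝ) ^ 2 * (k n : ℝ) ^ 2))) →
      Submatrix.DetectionImpossible m k (fun n => Submatrix.allBlocks n (k n))
        (fun n => Submatrix.meanShift (ϑ n)) ∧
      (Submatrix.VarAdmissible m k ϑ →
        Submatrix.DetectionImpossible m k (fun n => Submatrix.allBlocks n (k n))
          (fun n => Submatrix.varShift (ϑ n)))) ∧
    -- circular consecutive placements
    ((fun n => Submatrix.energy (ϑ n)) =o[atTop]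
        (fun n : ℕ => Real.log (1 + (n : ℝ) ^ 2 / ((k n : ℝ) ^ 2 * (m n : ℝ) ^ 2))) →
      Submatrix.DetectionImpossible m k (fun n => Submatrix.circBlocks n (k n))
        (fun n => Submatrix.meanShift (ϑ n)) ∧
      (Submatrix.VarAdmissible m k ϑ →
        Submatrix.DetectionImpossible m k (fun n => Submatrix.circBlocks n (k n))
          (fun n => Submatrix.varShift (ϑ n)))) := by
  obtain ⟨D, hD, hP⟩ := hsmooth.exists_meanShift hdim
  refine ⟨fun ho => ⟨Submatrix.detectionImpossible_allBlocks hdim D hD hP ho, fun hv => ?_⟩,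
    fun ho => ⟨Submatrix.detectionImpossible_circBlocks hdim D hD hP ho, fun hv => ?_⟩⟩
  · obtain ⟨D', hD', hP'⟩ := hsmooth.exists_varShift hdim hv
    exact Submatrix.detectionImpossible_allBlocks hdim D' hD' hP' ho
  · obtain ⟨D', hD', hP'⟩ := hsmooth.exists_varShift hdim hv
    exact Submatrix.detectionImpossible_circBlocks hdim D' hD' hP' ho
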